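/- Let $q$ be a power of a prime $p$, let $C$ be a nonsingular projective curve over $\mathbb{F}_q$, let $\infty$ be a closed point of $C$, and let $A$ be the ring of functions on $C$ regular everywhere except possibly at $\infty$. Let $K$ be a finitely generated field extension of $\mathbb{F}_q$, with algebraic closure $K^{\mathrm{alg}}$, and let $K\{\tau\}$ be the ring of polynomials in the operator $\tau(y)=y^q$ (multiplication is composition). Let $\phi:A\to K\{\tau\}$ be a Drinfeld module, i.e. an $\mathbb{F}_q$-algebra homomorphism such that the coefficient of $\tau^0$ in $\phi_a$ is $i(a)$ for a given $\mathbb{F}_q$-algebra homomorphism $i:A\to K$, and $\phi_a\neq i(a)\tau^0$ for some $a$. Assume that for some non-constant $t\in A$ (non-constant: transcendental over $\mathbb{F}_q$) $\phi_t=\sum_{i=0}^{r}a_i\tau^i$ is monic, $a_r=1$. Let $F$ be the algebraic closure of $\mathbb{F}_p$ in $K$ and $x_1,\dots,x_n$ a transcendence basis of $K/F$; put $K_0=F(x_1,\dots,x_n)$ and $R=F[x_1,\dots,x_n]$. Let $M_{K_0/F}$ consist of the valuations $v_P=\mathrm{ord}_P$ for $P\in R$ irreducible, of degree $d(v_P)=\deg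 P$ (total degree), and of $v_\infty=-\deg$, of degree $d(v_\infty)=1$. For a finite extension $L$ of $K_0$, with $F'$ the algebraic closure of $F$ in $L$, let $M_{L/F'}$ be the set of all discrete valuations $w$ of $L$, with value group $\mathbb{Z}$, lying over some $v\in M_{K_0/F}$, and put $d(w)=f(w|v)\,d(v)/[L:K_0]$, where $f(w|v)$ is the residue degree. If $L$ contains $K$, then for $w\in M_{L/F'}$, $y\in L$ and any non-constant $a\in A$ put $$V_w(y)=\lim_{m\to\infty}\frac{\min\{0,w(\phi_{a^m}(y))\}}{\deg\phi_{a^m}},\qquad \widehat h_w(y)=-d(w)V_w(y),\qquad \widehat h(y)=\sum_{w\in M_{L/F'}}\widehat h_w(y),$$ where $\deg\phi_{b}$ is the degree of $\phi_b$ as a polynomial map ($\deg \tau^i=q^i$). Let $x\in K^{\mathrm{alg}}$ be a non-torsion point, i.e. $\phi_a(x)\neq 0$ for all $a\in A\setminus\{0\}$. Let $F_x$ be the algebraic closure of $\mathbb{F}_p$ in $K(x)$, and let $S_x$ be the set of places $v\in M_{K(x)/F_x}$ of bad reduction for $\phi$, i.e. those for which it is not true that for every $a\in A\setminus\{0\}$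 all coefficients of $\phi_a$ are integral at $v$ and its leading coefficient is a unit at $v$. Then the limits $V_w(x)$ exist for all $w\in M_{K(x)/F_x}$, $S_x$ is finite, there is $v\in M_{K(x)/F_x}$ with $$\widehat h_v(x)>q^{-r(2+(r^2+r)|S_x|)}\,d(v),$$ and $$\widehat h(x)>\frac{q^{-r(2+(r^2+r)|S_x|)}}{[K(x):F(x_1,\dots,x_n)]}.$$ -/

import Mathlib

open Polynomial Filter Topology

/-! ### The coefficient ring `A` -/

/-- For a function field `Q` of one variable over `k`, the closed points of the nonsingular
projective curve `C` with function field `Q` are the valuation subrings `𝒪 ≠ ⊤` of `Q` containing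
`k`. Given one of them, `infty`, this is the ring of functions on `C` that are regular everywhere
except possibly at `infty`. -/
def regularAway (k Q : Type*) [Field k] [Field Q] [Algebra k Q] (infty : ValuationSubring Q) :
    Subalgebra k Q where
  carrier := {f | ∀ 𝒪 : ValuationSubring Q, (∀ c : k, algebraMap k Q c ∈ 𝒪) → 𝒪 ≠ infty → f ∈ 𝒪}
  mul_mem' hf hg 𝒪 h h' := 𝒪.mul_mem _ _ (hf 𝒪 h h') (hg 𝒪 h h')
  add_mem' hf hg 𝒪 h h' := 𝒪.add_mem _ _ (hf 𝒪 h h') (hg 𝒪 h h')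
  algebraMap_mem' c _ h _ := h c

/-! ### Drinfeld modules -/

/-- `f` is a `K`-linear combination of `X, X ^ q, X ^ (q ^ 2), …`. When `q` is the cardinality of a
finite subfield of `K`, such polynomials `∑ cᵢ X ^ (q ^ i)` represent the elements `∑ cᵢ τ ^ i` of
`K{τ}`, where `τ` is the `q`-power Frobenius: addition is the usual one and multiplication is the
composition of polynomials. -/
def IsLinearized {K : Type*} [Field K] (q : ℕ) (f : K[X]) : Prop :=
  ∀ m ∈ f.support, ∃ i : ℕ, m = q ^ i

/-- A Drinfeld `A`-module over `K`: a morphism of `k`-algebras `φ : A → K{τ}`, where `k` is the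
finite field with `q` elements, `K{τ}` is the ring of `q`-linearized polynomials under addition
and composition (the coefficient of `τ ^ i` is the coefficient of `X ^ (q ^ i)`, and `c τ ^ 0` is
`c X`), such that the constant coefficient (that of `τ ^ 0`) of `φ a` is `i a`, and such that
`φ a ≠ i(a) τ ^ 0` for some `a`. -/
structure DrinfeldModule (k A K : Type*) [Field k] [Fintype k] [CommRing A] [Algebra k A]
    [Field K] [Algebra k K] where
  /-- the structure morphism `i : A → K` -/
  i : A →ₐ[k] K
  /-- `φ a`, as a linearized polynomial -/
  φ : A → K[X]
  linearized : ∀ a, IsLinearized (Fintype.card k) (φ a)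
  map_algebraMap : ∀ c : k, φ (algebraMap k A c) = C (algebraMap k K c) * X
  map_add : ∀ a b, φ (a + b) = φ a + φ b
  map_mul : ∀ a b, φ (a * b) = (φ a).comp (φ b)
  coeff_one : ∀ a, (φ a).coeff 1 = i a
  nontrivial : ∃ a, φ a ≠ C (i a) * X

namespace DrinfeldModule

variable {k A K : Type*} [Field k] [Fintype k] [CommRing A] [Algebra k A] [Field K] [Algebra k K]

/-- The point `x` of an extension of `K` is a torsion point for `φ`. -/
def IsTorsion (D : DrinfeldModule k A K) {L : Type*} [Field L] [Algebra K L] (x : L) : Prop :=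
  ∃ a : A, a ≠ 0 ∧ aeval x (D.φ a) = 0

/-- `φ` has good reduction at the valuation `v` of an extension `L` of `K`: for all `a ≠ 0`, all
coefficients of `φ a` are integral at `v` and the leading coefficient is a unit at `v`. -/
def GoodReduction (D : DrinfeldModule k A K) {L : Type*} [Field L] [Algebra K L]
    (v : AddValuation L (WithTop ℤ)) : Prop :=
  ∀ a : A, a ≠ 0 → (∀ j, 0 ≤ v (algebraMap K L ((D.φ a).coeff j))) ∧
    v (algebraMap K L (D.φ a).leadingCoeff) = 0

/-- `ṽ(y) = min {0, v(y)}`, an integer. -/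
noncomputable def vTilde {L : Type*} [Field L] (v : AddValuation L (WithTop ℤ)) (y : L) : ℤ :=
  (min 0 (v y)).untopD 0

/-- The sequence `ṽ(φ_{a ^ m}(y)) / deg φ_{a ^ m}`. -/
noncomputable def heightSeq (D : DrinfeldModule k A K) {L : Type*} [Field L] [Algebra K L]
    (v : AddValuation L (WithTop ℤ)) (a : A) (y : L) (m : ℕ) : ℝ :=
  (vTilde v (aeval y (D.φ (a ^ m))) : ℝ) / ((D.φ (a ^ m)).natDegree : ℝ)

/-- The function `V_v`, computed with the (non-constant) element `a` of `A`. -/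
noncomputable def heightV (D : DrinfeldModule k A K) {L : Type*} [Field L] [Algebra K L]
    (v : AddValuation L (WithTop ℤ)) (a : A) (y : L) : ℝ :=
  limUnder atTop (D.heightSeq v a y)

end DrinfeldModule

/-! ### Places -/

/-- The valuation ring of `w`. -/
def valRing {L : Type*} [Field L] (w : AddValuation L (WithTop ℤ)) : ValuationSubring L :=
  (AddValuation.toValuation w).valuationSubring

theorem mem_valRing {L : Type*} [Field L] (w : AddValuation L (WithTop ℤ)) (y : L) :
    y ∈ valRing w ↔ 0 ≤ w y := Iff.rfl

/-- `w` lies over `v` as a place: the valuation ring of `v` is the trace of that of `w`. -/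
def LiesOver {K₀ L : Type*} [Field K₀] [Field L] [Algebra K₀ L]
    (w : AddValuation L (WithTop ℤ)) (v : AddValuation K₀ (WithTop ℤ)) : Prop :=
  (valRing w).comap (algebraMap K₀ L) = valRing v

/-- The inclusion of the valuation ring `W ∩ K₀` of `K₀` into the valuation ring `W` of `L`. -/
def traceHom (K₀ : Type*) {L : Type*} [Field K₀] [Field L] [Algebra K₀ L]
    (W : ValuationSubring L) : W.comap (algebraMap K₀ L) →+* W :=
  ((algebraMap K₀ L).comp (W.comap (algebraMap K₀ L)).subtype).codRestrict W.toSubring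
    (fun y => y.2)

instance traceHom_isLocalHom (K₀ : Type*) {L : Type*} [Field K₀] [Field L] [Algebra K₀ L]
    (W : ValuationSubring L) : IsLocalHom (traceHom K₀ W) where
  map_nonunit y hy := by
    obtain ⟨u, hu⟩ := hy
    have h1 : (u : W) * (↑u⁻¹ : W) = 1 := u.mul_inv
    have h2 : algebraMap K₀ L y * ((↑u⁻¹ : W) : L) = 1 := by
      have := congrArg (Subtype.val) h1
      rw [hu] at this
      exact this
    have h0 : (y : K₀) ≠ 0 := by
      intro h
      rw [h] at h2
      simp at h2
    have h3 : ((↑u⁻¹ : W) : L) = algebraMap K₀ L (y : K₀)⁻¹ := by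
      rw [map_inv₀]
      exact eq_inv_of_mul_eq_one_right h2
    have h4 : (y : K₀)⁻¹ ∈ W.comap (algebraMap K₀ L) := by
      rw [ValuationSubring.mem_comap, ← h3]
      exact (↑u⁻¹ : W).2
    exact IsUnit.of_mul_eq_one ⟨(y : K₀)⁻¹, h4⟩ (Subtype.ext (mul_inv_cancel₀ h0))

/-- The relative degree `f(w|v)`: the degree of the residue field of `w` over the residue field of
the place `v` of `K₀` below `w` (whose valuation ring is `valRing w ∩ K₀`). -/
noncomputable def relDegree (K₀ : Type*) {L : Type*} [Field K₀] [Field L] [Algebra K₀ L]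
    (w : AddValuation L (WithTop ℤ)) : ℕ :=
  letI := (IsLocalRing.ResidueField.map (traceHom K₀ (valRing w))).toAlgebra
  Module.finrank (IsLocalRing.ResidueField ((valRing w).comap (algebraMap K₀ L)))
    (IsLocalRing.ResidueField (valRing w))

section places

variable {F K₀ : Type*} [Field F] [Field K₀] [Algebra F K₀] {n : ℕ} (X : Fin n → K₀)

/-- `v` is the valuation `v_P` of the rational function field `K₀ = F(X₁, …, Xₙ)`: its value at a
nonzero polynomial `Q` is the order of `Q` at `P`. -/
def IsOrd (P : MvPolynomial (Fin n) F) (v : AddValuation K₀ (WithTop ℤ)) : Prop :=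
  ∀ Q : MvPolynomial (Fin n) F, Q ≠ 0 →
    v (MvPolynomial.aeval X Q) = (((multiplicity P Q : ℕ) : ℤ) : WithTop ℤ)

variable (F) in
/-- `v` is the valuation `v_∞` of the rational function field `K₀ = F(X₁, …, Xₙ)`: its value at a
nonzero polynomial `Q` is minus the total degree of `Q`. -/
def IsNegDeg (v : AddValuation K₀ (WithTop ℤ)) : Prop :=
  ∀ Q : MvPolynomial (Fin n) F, Q ≠ 0 →
    v (MvPolynomial.aeval X Q) = ((-(Q.totalDegree : ℤ) : ℤ) : WithTop ℤ)

variable (F) in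
/-- `IsRatPlace F X v d`: `v` belongs to the set `M_{K₀/F}` of valuations of the rational function
field `K₀ = F(X₁, …, Xₙ)`, and its degree is `d`. -/
inductive IsRatPlace : AddValuation K₀ (WithTop ℤ) → ℕ → Prop
  | finite (P : MvPolynomial (Fin n) F) (hP : Irreducible P)
      (v : AddValuation K₀ (WithTop ℤ)) (hv : IsOrd X P v) : IsRatPlace v P.totalDegree
  | infinite (v : AddValuation K₀ (WithTop ℤ)) (hv : IsNegDeg F X v) : IsRatPlace v 1

variable (F) in
/-- The set `M_{L/F'}` for a finite extension `L` of `K₀ = F(X₁, …, Xₙ)`: all discrete valuations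
of `L`, normalized to have value group `ℤ`, that lie over a valuation in `M_{K₀/F}`. -/
def places (L : Type*) [Field L] [Algebra K₀ L] : Set (AddValuation L (WithTop ℤ)) :=
  {w | Function.Surjective w ∧ ∃ v d, IsRatPlace F X v d ∧ LiesOver w v}

open Classical in
variable (F) in
/-- The degree `d(w) = f(w|v) d(v) / [L : K₀]` of `w ∈ M_{L/F'}`, where `v ∈ M_{K₀/F}` is the
valuation below `w`; the integer `d(v)` is determined by `w` (outside `M_{L/F'}` the value is the
irrelevant number `0`). -/
noncomputable def placeDegree {L : Type*} [Field L] [Algebra K₀ L]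
    (w : AddValuation L (WithTop ℤ)) : ℝ :=
  if h : ∃ d v, IsRatPlace F X v d ∧ LiesOver w v then
    (relDegree K₀ w : ℝ) * (h.choose : ℝ) / (Module.finrank K₀ L : ℝ)
  else 0

variable {k A K L : Type*} [Field k] [Fintype k] [CommRing A] [Algebra k A] [Field K] [Algebra k K]
  [Field L] [Algebra K L] [Algebra K₀ L]

variable (F) in
/-- The local height `ĥ_w(y) = - d(w) V_w(y)`. -/
noncomputable def localHeight (D : DrinfeldModule k A K) (a : A) (w : AddValuation L (WithTop ℤ))
    (y : L) : ℝ :=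
  -placeDegree F X w * D.heightV w a y

variable (F) in
/-- The global height, the sum of the local heights over `M_{L/F'}`. -/
noncomputable def globalHeight (D : DrinfeldModule k A K) (a : A) (y : L) : ℝ :=
  ∑ᶠ w ∈ places F X L, localHeight F X D a w y

variable (F L) in
/-- The places in `M_{L/F'}` at which the Drinfeld module has bad reduction. -/
def badPlaces (D : DrinfeldModule k A K) : Set (AddValuation L (WithTop ℤ)) :=
  {w | w ∈ places F X L ∧ ¬ D.GoodReduction w}

end places

/-- The rational function field `F(X₁, …, Xₙ)` inside `K`. -/
abbrev ratField {F K : Type*} [Field F] [Field K] [Algebra F K] {n : ℕ} (X : Fin n → K) :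
    IntermediateField F K :=
  IntermediateField.adjoin F (Set.range X)

/-- The elements `X₁, …, Xₙ` of `F(X₁, …, Xₙ)`. -/
def ratGen (F : Type*) {K : Type*} [Field F] [Field K] [Algebra F K] {n : ℕ} (X : Fin n → K)
    (j : Fin n) : ratField (F := F) X :=
  ⟨X j, IntermediateField.subset_adjoin F _ ⟨j, rfl⟩⟩

/-! ### Truncated valuations of polynomial values -/

namespace DrinfeldModule

section vTilde

variable {L : Type*} [Field L] (v : AddValuation L (WithTop ℤ))

/-! Write q for the cardinality of k, s for the number of bad places and N = 2 + (r² + r)s. Assume,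
for contradiction, that -V_w(ξ) ≤ q^(-rN) at every place w of L = K(x), with ξ = x. The argument
studies the points φ_{g(t)}(ξ) for polynomials g over k of small degree. They are pairwise distinct
because ξ is not torsion.

Call z escaping at w if w(z) < 0 and the leading term of φ_t strictly dominates at z (`Escapes`).
This persists under φ_t, so V_w(z) = w(z) ≤ -1 by integrality of the valuation. Since V_w(φ_b(ξ)) =
deg φ_b · V_w(ξ) and deg φ_{g(t)} ≤ q^(r deg g), no φ_{g(t)}(ξ) with g ≠ 0 and deg g < N can escape
(`pointHom_not_escapes`). At a good place, negative valuation already means escaping, so these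
points are integral there.

At a bad place, a point of valuation at most 0 whose image under φ_t shows no cancellation has an
escaping image (`exists_escapes_of_le`, with one exception). So all such points cancel. On each
level of the valuation, cancellation forces leading residues to be roots of a linearized polynomial
whose degree is read off from a Newton polygon. These degrees multiply to at most q^r
(`card_le_card_levelSubgroup`), so the points of positive valuation form a subgroup of index at most
q^r.

Intersecting over the s bad places, inside the q^(N-1) points with deg g < N - 1, leaves at least q²
points. A nonzero one is integral at every place, hence algebraic over k, hence of valuation 0
everywhere, but it has positive valuation at a bad place. If s = 0, then ξ and the coefficients of
φ_t are constants and ξ is torsion. The exception q = 2, r = 1 uses nonnegative instead of positive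
valuations and a point other than 0 and -1, whose second image under φ_t escapes
(`false_of_card_eq_two`).

The remaining work is foundational: existence of the limits, φ_a having degree at least 2 for
nonconstant a, finiteness of the bad set, and the fact that a function without poles in the given
set of places is constant. -/

theorem coe_vTilde (y : L) : ((vTilde v y : ℤ) : WithTop ℤ) = min 0 (v y) := by
  unfold vTilde
  cases h : v y with
  | top => simp
  | coe n =>
    have : (min 0 (n : WithTop ℤ)) = ((min 0 n : ℤ) : WithTop ℤ) := by norm_cast
    rw [this, WithTop.untopD_coe]

theorem vTilde_nonpos (y : L) : vTilde v y ≤ 0 := by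
  have h : ((vTilde v y : ℤ) : WithTop ℤ) ≤ (0 : ℤ) := by
    rw [coe_vTilde]; exact min_le_left _ _
  exact_mod_cast h

theorem coe_vTilde_le (y : L) : ((vTilde v y : ℤ) : WithTop ℤ) ≤ v y := by
  rw [coe_vTilde]; exact min_le_right _ _

theorem vTilde_eq_zero {y : L} (h : 0 ≤ v y) : vTilde v y = 0 := by
  have : ((vTilde v y : ℤ) : WithTop ℤ) = (0 : ℤ) := by
    rw [coe_vTilde]; exact min_eq_left h
  exact_mod_cast this

theorem vTilde_eq_of_neg {y : L} (h : v y < 0) : ((vTilde v y : ℤ) : WithTop ℤ) = v y := by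
  rw [coe_vTilde]; exact min_eq_right h.le

theorem vTilde_neg_iff {y : L} : vTilde v y < 0 ↔ v y < 0 := by
  constructor
  · intro h
    by_contra h'
    rw [vTilde_eq_zero v (not_lt.mp h')] at h
    exact lt_irrefl _ h
  · intro h
    have := vTilde_eq_of_neg v h
    rw [← this] at h
    exact_mod_cast h

theorem le_vTilde {y : L} {c : ℤ} (h0 : c ≤ 0) (h : (c : WithTop ℤ) ≤ v y) : c ≤ vTilde v y := by
  have : (c : WithTop ℤ) ≤ ((vTilde v y : ℤ) : WithTop ℤ) := by
    rw [coe_vTilde]; exact le_min (by exact_mod_cast h0) h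
  exact_mod_cast this

theorem coe_mul_le_map_pow {y : L} {e : ℤ} (h : (e : WithTop ℤ) ≤ v y) (i : ℕ) :
    ((i * e : ℤ) : WithTop ℤ) ≤ v (y ^ i) := by
  rw [v.map_pow]
  calc ((i * e : ℤ) : WithTop ℤ) = i • (e : WithTop ℤ) := by
        rw [← WithTop.coe_nsmul]; simp
    _ ≤ i • v y := nsmul_le_nsmul_right h i

theorem map_pow_eq_coe {y : L} {e : ℤ} (h : v y = (e : WithTop ℤ)) (i : ℕ) :
    v (y ^ i) = ((i * e : ℤ) : WithTop ℤ) := by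
  rw [v.map_pow, h, ← WithTop.coe_nsmul]; simp

variable {K : Type*} [Field K] [Algebra K L]

/-- When v(y) is very negative the leading term of g strictly dominates and v(g(y)) is exact;
otherwise both truncated values stay bounded. The bound is uniform in y, which is what the limit
argument needs. -/
theorem exists_abs_vTilde_aeval_le {g : K[X]} (hg : g ≠ 0) :
    ∃ C : ℤ, ∀ y : L, |vTilde v (aeval y g) - g.natDegree * vTilde v y| ≤ C := by
  set d := g.natDegree
  obtain ⟨l, hl⟩ : ∃ l : ℤ, v (algebraMap K L g.leadingCoeff) = (l : WithTop ℤ) := by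
    have : v (algebraMap K L g.leadingCoeff) ≠ ⊤ := by
      rw [v.ne_top_iff]; simpa using hg
    obtain ⟨l, hl⟩ := WithTop.ne_top_iff_exists.mp this
    exact ⟨l, hl.symm⟩
  obtain ⟨B, hB0, hlB, hB⟩ : ∃ B : ℤ, 0 ≤ B ∧ l ≤ B ∧
      ∀ i, ((-B : ℤ) : WithTop ℤ) ≤ v (algebraMap K L (g.coeff i)) := by
    refine ⟨|l| + ∑ i ∈ g.support, |vTilde v (algebraMap K L (g.coeff i))|, ?_, ?_, ?_⟩
    · positivity
    · have := le_abs_self l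
      have h2 : 0 ≤ ∑ i ∈ g.support, |vTilde v (algebraMap K L (g.coeff i))| := by positivity
      linarith
    · intro i
      refine le_trans ?_ (coe_vTilde_le v _)
      norm_cast
      by_cases hi : i ∈ g.support
      · have h1 := Finset.single_le_sum
          (f := fun i => |vTilde v (algebraMap K L (g.coeff i))|) (fun i _ => abs_nonneg _) hi
        have h2 := neg_abs_le (vTilde v (algebraMap K L (g.coeff i)))
        have h3 := abs_nonneg l
        linarith
      · have h1 : 0 ≤ ∑ i ∈ g.support, |vTilde v (algebraMap K L (g.coeff i))| := by positivity
        have h2 : vTilde v (algebraMap K L (g.coeff i)) = 0 := by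
          apply vTilde_eq_zero
          rw [Polynomial.notMem_support_iff.mp hi]; simp
        rw [h2]
        have h3 := abs_nonneg l
        linarith
  have hB' : ∀ {y : L} {e : ℤ}, (e : WithTop ℤ) ≤ v y → ∀ i : ℕ,
      ((-B + i * e : ℤ) : WithTop ℤ) ≤ v (algebraMap K L (g.coeff i) * y ^ i) := by
    intro y e he i
    rw [v.map_mul, WithTop.coe_add]
    exact add_le_add (hB i) (coe_mul_le_map_pow v he i)
  have hsum : ∀ y : L, aeval y g = ∑ i ∈ Finset.range (d + 1),
      algebraMap K L (g.coeff i) * y ^ i := by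
    intro y
    rw [aeval_eq_sum_range]
    simp [Algebra.smul_def, d]
  -- Here B bounds the valuations of the coefficients. The leading term wins as soon as ṽ(y) < -2B,
  -- and 2dB absorbs the remaining range.
  refine ⟨B + 2 * d * B, fun y => ?_⟩
  have hd0 : (0 : ℤ) ≤ d := by positivity
  have hy0 := vTilde_nonpos v y
  have hlow : d * vTilde v y - B ≤ vTilde v (aeval y g) := by
    apply le_vTilde
    · nlinarith
    · rw [hsum]
      apply v.map_le_sum
      intro i hi
      refine le_trans ?_ (hB' (coe_vTilde_le v y) i)
      norm_cast
      have : (i : ℤ) ≤ d := by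
        have := Finset.mem_range.mp hi
        omega
      nlinarith
  have hup : vTilde v (aeval y g) ≤ d * vTilde v y + (B + 2 * d * B) := by
    by_cases hsmall : -(2 * B) ≤ vTilde v y
    · have := vTilde_nonpos v (aeval y g)
      nlinarith
    · push Not at hsmall
      have hneg : v y < 0 := (vTilde_neg_iff v).mp (by linarith)
      have he := vTilde_eq_of_neg v hneg
      set e := vTilde v y
      have hval : v (aeval y g) = ((l + d * e : ℤ) : WithTop ℤ) := by
        rw [hsum, Finset.sum_range_succ]
        have htop : v (algebraMap K L (g.coeff d) * y ^ d) = ((l + d * e : ℤ) : WithTop ℤ) := by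
          rw [v.map_mul, map_pow_eq_coe v he.symm, WithTop.coe_add, ← hl]
          rfl
        rw [v.map_add_eq_of_lt_right, htop]
        rw [htop]
        apply v.map_lt_sum (WithTop.coe_ne_top)
        intro i hi
        refine lt_of_lt_of_le ?_ (hB' he.le i)
        norm_cast
        have : (i : ℤ) + 1 ≤ d := by
          have := Finset.mem_range.mp hi
          omega
        nlinarith
      have h1 := coe_vTilde_le v (aeval y g)
      rw [hval] at h1
      have h2 : vTilde v (aeval y g) ≤ l + d * e := by exact_mod_cast h1
      nlinarith
  rw [abs_le]
  constructor
  · nlinarith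
  · linarith

end vTilde

/-! ### Local heights -/

/-- Tate's telescoping argument: successive quotients differ by at most C / 2 ^ (m + 1), and these
errors add up to C. -/
theorem exists_tendsto_div_pow {u : ℕ → ℝ} {d C : ℝ} (hd : 2 ≤ d)
    (h : ∀ m, |u (m + 1) - d * u m| ≤ C) :
    ∃ V, Tendsto (fun m => u m / d ^ m) atTop (𝓝 V) ∧ |u 0 - V| ≤ C := by
  have hC : 0 ≤ C := (abs_nonneg _).trans (h 0)
  have hdpos : 0 < d := by linarith
  have hdist : ∀ n, dist (u n / d ^ n) (u (n + 1) / d ^ (n + 1)) ≤ C / 2 * (1 / 2) ^ n := by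
    intro n
    rw [dist_comm, Real.dist_eq]
    have : u (n + 1) / d ^ (n + 1) - u n / d ^ n = (u (n + 1) - d * u n) / d ^ (n + 1) := by
      field_simp
      ring
    rw [this, abs_div, abs_of_pos (pow_pos hdpos _)]
    have h2 : (2 : ℝ) ^ (n + 1) ≤ d ^ (n + 1) := by gcongr
    calc _ ≤ C / 2 ^ (n + 1) := by
          gcongr
          exact h n
      _ = _ := by rw [pow_succ, one_div, inv_pow]; field_simp
  obtain ⟨V, hV⟩ := cauchySeq_tendsto_of_complete
    (cauchySeq_of_le_geometric (1 / 2) (C / 2) (by norm_num) hdist)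
  refine ⟨V, hV, ?_⟩
  have := dist_le_of_le_geometric_of_tendsto₀ (1 / 2) (C / 2) (by norm_num) hdist hV
  rw [Real.dist_eq] at this
  simp only [pow_zero, div_one] at this
  refine this.trans (le_of_eq ?_)
  ring

variable {k A K : Type*} [Field k] [Fintype k] [CommRing A] [Algebra k A] [Field K] [Algebra k K]
  (D : DrinfeldModule k A K)

theorem φ_one : D.φ 1 = X := by
  have := D.map_algebraMap 1
  simpa using this

theorem natDegree_φ_mul (a b : A) :
    (D.φ (a * b)).natDegree = (D.φ a).natDegree * (D.φ b).natDegree := by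
  rw [D.map_mul, natDegree_comp]

theorem natDegree_φ_pow (a : A) (m : ℕ) : (D.φ (a ^ m)).natDegree = (D.φ a).natDegree ^ m := by
  induction m with
  | zero => simp [φ_one]
  | succ m ih => rw [pow_succ, natDegree_φ_mul, ih, pow_succ]

variable {L : Type*} [Field L] [Algebra K L]

theorem aeval_φ_mul (a b : A) (y : L) :
    aeval y (D.φ (a * b)) = aeval (aeval y (D.φ b)) (D.φ a) := by
  rw [D.map_mul, aeval_comp]

theorem aeval_φ_comm (a b : A) (y : L) :
    aeval (aeval y (D.φ b)) (D.φ a) = aeval (aeval y (D.φ a)) (D.φ b) := by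
  rw [← aeval_φ_mul, mul_comm, aeval_φ_mul]

variable (v : AddValuation L (WithTop ℤ)) {a : A} (ha : 2 ≤ (D.φ a).natDegree)
include ha

theorem exists_tendsto_heightSeq :
    ∃ C : ℝ, ∀ y : L, Tendsto (D.heightSeq v a y) atTop (𝓝 (D.heightV v a y)) ∧
      |(vTilde v y : ℝ) - D.heightV v a y| ≤ C := by
  have hne : D.φ a ≠ 0 := by
    intro h
    rw [h] at ha
    simp at ha
  obtain ⟨C, hC⟩ := exists_abs_vTilde_aeval_le v hne
  refine ⟨C, fun y => ?_⟩
  obtain ⟨V, hV, hV'⟩ := exists_tendsto_div_pow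
    (u := fun m => (vTilde v (aeval y (D.φ (a ^ m))) : ℝ)) (d := (D.φ a).natDegree) (C := C)
    (by exact_mod_cast ha) (fun m => by
      have := hC (aeval y (D.φ (a ^ m)))
      rw [← aeval_φ_mul, ← pow_succ'] at this
      exact_mod_cast this)
  have hseq : D.heightSeq v a y = fun m =>
      (vTilde v (aeval y (D.φ (a ^ m))) : ℝ) / ((D.φ a).natDegree : ℝ) ^ m := by
    funext m
    rw [heightSeq, natDegree_φ_pow]
    push_cast
    rfl
  rw [← hseq] at hV
  have hlim : D.heightV v a y = V := hV.limUnder_eq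
  rw [hlim]
  refine ⟨hV, ?_⟩
  simpa [φ_one] using hV'

theorem tendsto_heightSeq (y : L) :
    Tendsto (D.heightSeq v a y) atTop (𝓝 (D.heightV v a y)) :=
  ((D.exists_tendsto_heightSeq v ha).choose_spec y).1

theorem heightV_nonpos (y : L) : D.heightV v a y ≤ 0 := by
  refine le_of_tendsto (D.tendsto_heightSeq v ha y) (Eventually.of_forall fun m => ?_)
  apply div_nonpos_of_nonpos_of_nonneg
  · exact_mod_cast vTilde_nonpos v _
  · positivity

theorem heightV_eq_zero {y : L} (h : ∀ m, 0 ≤ v (aeval y (D.φ (a ^ m)))) :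
    D.heightV v a y = 0 := by
  refine tendsto_nhds_unique (D.tendsto_heightSeq v ha y) ?_
  have : D.heightSeq v a y = fun _ => 0 := by
    funext m
    rw [heightSeq, vTilde_eq_zero v (h m)]
    simp
  rw [this]
  exact tendsto_const_nhds

/-- φ_b commutes with every φ_{a^m}, and the bounded error of `exists_abs_vTilde_aeval_le` for φ_b
disappears after division by deg φ_{a^m}. -/
theorem heightV_aeval_φ {b : A} (hb : D.φ b ≠ 0) (y : L) :
    D.heightV v a (aeval y (D.φ b)) = (D.φ b).natDegree * D.heightV v a y := by
  refine tendsto_nhds_unique (D.tendsto_heightSeq v ha _) ?_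
  obtain ⟨C, hC⟩ := exists_abs_vTilde_aeval_le v hb
  have h1 := (D.tendsto_heightSeq v ha y).const_mul ((D.φ b).natDegree : ℝ)
  rw [← add_zero ((D.φ b).natDegree * D.heightV v a y)]
  have h2 : Tendsto (fun m => D.heightSeq v a (aeval y (D.φ b)) m -
      (D.φ b).natDegree * D.heightSeq v a y m) atTop (𝓝 0) := by
    have hlim : Tendsto (fun m : ℕ => (C : ℝ) * (1 / 2) ^ m) atTop (𝓝 0) := by
      have := (tendsto_pow_atTop_nhds_zero_of_lt_one (r := (1 / 2 : ℝ)) (by norm_num)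
        (by norm_num)).const_mul (C : ℝ)
      simpa using this
    refine squeeze_zero_norm (fun m => ?_) hlim
    have hdeg : ((2 : ℝ)) ^ m ≤ ((D.φ (a ^ m)).natDegree : ℝ) := by
      rw [natDegree_φ_pow]
      push_cast
      gcongr
      exact_mod_cast ha
    have hpos : (0 : ℝ) < ((D.φ (a ^ m)).natDegree : ℝ) := lt_of_lt_of_le (by positivity) hdeg
    rw [heightSeq, heightSeq, aeval_φ_comm, ← mul_div_assoc, ← sub_div, Real.norm_eq_abs, abs_div,
      abs_of_pos hpos]
    have hm : |(vTilde v (aeval (aeval y (D.φ (a ^ m))) (D.φ b)) : ℝ) -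
        (D.φ b).natDegree * (vTilde v (aeval y (D.φ (a ^ m))) : ℝ)| ≤ C := by
      exact_mod_cast hC (aeval y (D.φ (a ^ m)))
    have hC0 : (0 : ℝ) ≤ C := (abs_nonneg _).trans hm
    calc _ ≤ (C : ℝ) / 2 ^ m := by gcongr
      _ = _ := by rw [one_div, inv_pow]; rfl
  have := h1.add h2
  simpa using this

/-- This allows V, defined through a, to be computed by iterating another element b. The difference
between ṽ and V is bounded, yet it is multiplied by (deg φ_b)^m along the b-orbit, so it vanishes.
-/
theorem heightV_eq_vTilde {b : A} (hb : 2 ≤ (D.φ b).natDegree) {y : L}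
    (h : ∀ m, (vTilde v (aeval y (D.φ (b ^ m))) : ℝ) =
      ((D.φ b).natDegree : ℝ) ^ m * vTilde v y) :
    D.heightV v a y = vTilde v y := by
  obtain ⟨C, hC⟩ := D.exists_tendsto_heightSeq v ha
  by_contra hne
  have hpos : 0 < |(vTilde v y : ℝ) - D.heightV v a y| := by
    rw [abs_pos, sub_ne_zero]
    exact fun h => hne h.symm
  obtain ⟨m, hm⟩ := pow_unbounded_of_one_lt
    (C / |(vTilde v y : ℝ) - D.heightV v a y|) (one_lt_two (α := ℝ))
  rw [div_lt_iff₀ hpos] at hm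
  have hbm : D.φ (b ^ m) ≠ 0 := by
    intro h0
    have := D.natDegree_φ_pow b m
    rw [h0, natDegree_zero] at this
    have h2 : 0 < (D.φ b).natDegree ^ m := by positivity
    omega
  have h1 := (hC (aeval y (D.φ (b ^ m)))).2
  rw [h m, D.heightV_aeval_φ v ha hbm, natDegree_φ_pow] at h1
  push_cast at h1
  rw [← mul_sub, abs_mul, abs_of_nonneg (by positivity)] at h1
  have h2 : (2 : ℝ) ^ m ≤ ((D.φ b).natDegree : ℝ) ^ m := by
    gcongr
    exact_mod_cast hb
  have h3 := mul_le_mul_of_nonneg_right h2 hpos.le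
  linarith

end DrinfeldModule

/-! ### Residue fields of valuations -/

theorem isUnit_valRing_iff {L : Type*} [Field L] (v : AddValuation L (WithTop ℤ)) (x : valRing v) :
    IsUnit x ↔ v (x : L) = 0 := by
  constructor
  · rintro ⟨u, rfl⟩
    have h1 : ((u : valRing v) : L) * ((↑u⁻¹ : valRing v) : L) = 1 :=
      congrArg Subtype.val u.mul_inv
    have h2 := congrArg v h1
    rw [v.map_mul, v.map_one] at h2
    have h3 : 0 ≤ v ((u : valRing v) : L) := (u : valRing v).2
    have h4 : 0 ≤ v ((↑u⁻¹ : valRing v) : L) := (↑u⁻¹ : valRing v).2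
    exact le_antisymm (by
      calc v ((u : valRing v) : L) ≤ v ((u : valRing v) : L) + v ((↑u⁻¹ : valRing v) : L) :=
            le_add_of_nonneg_right h4
        _ = 0 := h2) h3
  · intro h
    have hx : (x : L) ≠ 0 := by
      intro h0
      rw [h0, v.map_zero] at h
      exact absurd h (by simp)
    have hinv : v (x : L)⁻¹ = 0 := by rw [AddValuation.map_inv, h]; simp
    exact IsUnit.of_mul_eq_one ⟨(x : L)⁻¹, (mem_valRing v _).mpr hinv.ge⟩
      (Subtype.ext (mul_inv_cancel₀ hx))

theorem residue_valRing_eq_zero_iff {L : Type*} [Field L] (v : AddValuation L (WithTop ℤ))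
    (x : valRing v) : IsLocalRing.residue (valRing v) x = 0 ↔ 0 < v (x : L) := by
  rw [IsLocalRing.residue_eq_zero_iff, IsLocalRing.mem_maximalIdeal, mem_nonunits_iff,
    isUnit_valRing_iff]
  have h : 0 ≤ v (x : L) := x.2
  exact ⟨fun h' => lt_of_le_of_ne h (Ne.symm h'), fun h' => h'.ne'⟩

theorem AddValuation.exists_eq_coe {L : Type*} [Field L] (v : AddValuation L (WithTop ℤ)) {y : L}
    (hy : y ≠ 0) : ∃ n : ℤ, v y = (n : WithTop ℤ) := by
  obtain ⟨n, hn⟩ := WithTop.ne_top_iff_exists.mp (v.ne_top_iff.mpr hy)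
  exact ⟨n, hn.symm⟩

theorem AddValuation.ne_zero_of_eq_coe {L : Type*} [Field L] (v : AddValuation L (WithTop ℤ))
    {y : L} {n : ℤ} (h : v y = (n : WithTop ℤ)) : y ≠ 0 := by
  rintro rfl
  rw [v.map_zero] at h
  exact WithTop.top_ne_coe h

/-! ### Counting points of small height in a finite group -/

section counting

variable {L : Type*} [Field L] (v : AddValuation L (WithTop ℤ))
  {G : Type*} [AddCommGroup G] (θ : G →+ L)

/-- The elements of `G` whose image in `L` has valuation at least `α`. -/
def levelSubgroup (α : ℤ) : AddSubgroup G where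
  carrier := {g | (α : WithTop ℤ) ≤ v (θ g)}
  zero_mem' := by simp
  add_mem' hg hh := by
    simp only [Set.mem_ofPred_eq, map_add] at *
    exact v.map_le_add hg hh
  neg_mem' hg := by
    simp only [Set.mem_ofPred_eq, map_neg, AddValuation.map_neg] at *
    exact hg

theorem mem_levelSubgroup {α : ℤ} {g : G} :
    g ∈ levelSubgroup v θ α ↔ (α : WithTop ℤ) ≤ v (θ g) := Iff.rfl

/-- `J` and `I` are the least and the greatest index at which the terms of
`∑ i ∈ range (r + 1), a i * y ^ q ^ i` take their minimal valuation `m` when `v y = α`. -/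
structure IsMinimalRange (q r : ℕ) (a : ℕ → L) (α : ℤ) (J I : ℕ) (m : ℤ) : Prop where
  le : J ≤ I
  le_r : I ≤ r
  left_eq : v (a J) + ((q ^ J * α : ℤ) : WithTop ℤ) = (m : WithTop ℤ)
  right_eq : v (a I) + ((q ^ I * α : ℤ) : WithTop ℤ) = (m : WithTop ℤ)
  min_le : ∀ i ≤ r, (m : WithTop ℤ) ≤ v (a i) + ((q ^ i * α : ℤ) : WithTop ℤ)
  lt_of_lt : ∀ i ≤ r, i < J → (m : WithTop ℤ) < v (a i) + ((q ^ i * α : ℤ) : WithTop ℤ)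
  lt_of_gt : ∀ i ≤ r, I < i → (m : WithTop ℤ) < v (a i) + ((q ^ i * α : ℤ) : WithTop ℤ)

theorem exists_isMinimalRange (q : ℕ) {r : ℕ} {a : ℕ → L} (har : a r ≠ 0) (α : ℤ) :
    ∃ J I m, IsMinimalRange v q r a α J I m := by
  classical
  set l : ℕ → WithTop ℤ := fun i => v (a i) + ((q ^ i * α : ℤ) : WithTop ℤ) with hl
  obtain ⟨i₀, hi₀, hmin⟩ := Finset.exists_min_image (Finset.range (r + 1)) l ⟨r, by simp⟩
  have hr : l r ≠ ⊤ := by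
    obtain ⟨n, hn⟩ := v.exists_eq_coe har
    simp only [hl, hn, ← WithTop.coe_add]
    exact WithTop.coe_ne_top
  have htop : l i₀ ≠ ⊤ := ne_top_of_le_ne_top hr (hmin r (by simp))
  obtain ⟨m, hm⟩ := WithTop.ne_top_iff_exists.mp htop
  set T := (Finset.range (r + 1)).filter (fun i => l i = m) with hT
  have hne : T.Nonempty := ⟨i₀, by simp only [hT, Finset.mem_filter]; exact ⟨hi₀, hm.symm⟩⟩
  have hTmem : ∀ i, i ∈ T ↔ i ≤ r ∧ l i = m := by
    intro i
    rw [hT, Finset.mem_filter, Finset.mem_range, Nat.lt_succ_iff]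
  have hle : ∀ i ≤ r, (m : WithTop ℤ) ≤ l i := fun i hi => by
    rw [hm]; exact hmin i (Finset.mem_range.mpr (by omega))
  refine ⟨T.min' hne, T.max' hne, m, ?_⟩
  have hJ := (hTmem _).mp (T.min'_mem hne)
  have hI := (hTmem _).mp (T.max'_mem hne)
  refine ⟨Finset.min'_le _ _ (T.max'_mem hne), hI.1, hJ.2, hI.2, hle, ?_, ?_⟩
  · intro i hi hlt
    refine lt_of_le_of_ne (hle i hi) fun h => ?_
    exact absurd (T.min'_le i ((hTmem i).mpr ⟨hi, h.symm⟩)) (not_le.mpr hlt)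
  · intro i hi hlt
    refine lt_of_le_of_ne (hle i hi) fun h => ?_
    exact absurd (T.le_max' i ((hTmem i).mpr ⟨hi, h.symm⟩)) (not_le.mpr hlt)

-- Monotonicity of the Newton polygon: raising α by one adds q^i to the i-th term, so the minimum
-- moves to smaller indices.
variable {v} in
theorem IsMinimalRange.le_of_succ {q r : ℕ} (hq : 2 ≤ q) {a : ℕ → L} {α : ℤ}
    {J I J' I' : ℕ} {m m' : ℤ}
    (h : IsMinimalRange v q r a α J I m) (h' : IsMinimalRange v q r a (α + 1) J' I' m') :
    I' ≤ J := by
  by_contra hlt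
  push Not at hlt
  obtain ⟨x, hx⟩ : ∃ x : ℤ, v (a J) = x := by
    refine v.exists_eq_coe fun h0 => ?_
    have := h.left_eq
    rw [h0, v.map_zero] at this
    simp at this
  obtain ⟨x', hx'⟩ : ∃ x : ℤ, v (a I') = x := by
    refine v.exists_eq_coe fun h0 => ?_
    have := h'.right_eq
    rw [h0, v.map_zero] at this
    simp at this
  have h1 := h.left_eq
  have h2 := h.min_le I' h'.le_r
  have h3 := h'.right_eq
  have h4 := h'.min_le J (h.le.trans h.le_r)
  rw [hx] at h1 h4
  rw [hx'] at h2 h3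
  norm_cast at h1 h2 h3 h4
  have h5 : (q ^ J : ℤ) < q ^ I' := by
    exact_mod_cast Nat.pow_lt_pow_right hq hlt
  push_cast at *
  nlinarith

variable [Finite G]

/-- Cancellation kills the residue of the sum of minimal terms. After scaling by one element of
exact valuation α, the leading residues are therefore roots of the reduced polynomial, which has
only the exponents q^i with J ≤ i ≤ I. -/
theorem card_levelSubgroup_le {p e : ℕ} [CharP L p] [Fact p.Prime] (he : e ≠ 0) {r : ℕ}
    {a : ℕ → L} {α : ℤ} {J I : ℕ} {m : ℤ} (h : IsMinimalRange v (p ^ e) r a α J I m)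
    (hcancel : ∀ g, v (θ g) = (α : WithTop ℤ) →
      (m : WithTop ℤ) < v (∑ i ∈ Finset.range (r + 1), a i * θ g ^ (p ^ e) ^ i)) :
    Nat.card (levelSubgroup v θ α) ≤
      Nat.card (levelSubgroup v θ (α + 1)) * (p ^ e) ^ (I - J) := by
  classical
  have hp : p.Prime := Fact.out
  set q := p ^ e with hq
  have hqpos : 0 < q := pow_pos hp.pos e
  by_cases hex : ∃ g, v (θ g) = (α : WithTop ℤ)
  swap
  -- Without an element of valuation exactly α the two level subgroups coincide.
  · push Not at hex
    have : levelSubgroup v θ α ≤ levelSubgroup v θ (α + 1) := by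
      intro g hg
      rw [mem_levelSubgroup] at *
      have hlt := lt_of_le_of_ne hg (hex g).symm
      cases hv : v (θ g) with
      | top => simp
      | coe n =>
        rw [hv] at hlt
        norm_cast at *
    calc _ ≤ Nat.card (levelSubgroup v θ (α + 1)) :=
          Nat.card_le_card_of_injective _ (AddSubgroup.inclusion_injective this)
      _ ≤ _ := Nat.le_mul_of_pos_right _ (by positivity)
  obtain ⟨g₀, hg₀⟩ := hex
  set y₀ := θ g₀
  have hy₀ : y₀ ≠ 0 := v.ne_zero_of_eq_coe hg₀
  have hdiv : ∀ y, v (y / y₀) = v y + ((-α : ℤ) : WithTop ℤ) := by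
    intro y
    rw [div_eq_mul_inv, v.map_mul, AddValuation.map_inv, hg₀]
    rfl
  have hmem : ∀ g ∈ levelSubgroup v θ α, 0 ≤ v (θ g / y₀) := by
    intro g hg
    rw [mem_levelSubgroup] at hg
    rw [hdiv]
    calc (0 : WithTop ℤ) = (α : WithTop ℤ) + ((-α : ℤ) : WithTop ℤ) := by
          rw [← WithTop.coe_add]; simp
      _ ≤ _ := by gcongr
  let ρ : levelSubgroup v θ α →+ IsLocalRing.ResidueField (valRing v) :=
    { toFun := fun g => IsLocalRing.residue (valRing v) ⟨θ g / y₀, hmem g g.2⟩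
      map_zero' := by
        rw [residue_valRing_eq_zero_iff]
        simp
      map_add' := by
        intro g h
        rw [← map_add]
        congr 1
        ext
        simp [add_div] }
  have hρ : ∀ g, ρ g = IsLocalRing.residue (valRing v) ⟨θ g / y₀, hmem g g.2⟩ := fun g => rfl
  have hρ0 : ∀ g, ρ g = 0 ↔ (α : WithTop ℤ) < v (θ g) := by
    intro g
    rw [hρ, residue_valRing_eq_zero_iff]
    simp only [hdiv]
    cases hv : v (θ g) with
    | top => simp
    | coe n =>
      norm_cast
      omega
  have hker : Nat.card ρ.ker ≤ Nat.card (levelSubgroup v θ (α + 1)) := by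
    refine Nat.card_le_card_of_injective
      (fun g : ρ.ker => (⟨(g : levelSubgroup v θ α), ?_⟩ : levelSubgroup v θ (α + 1))) ?_
    · have := (hρ0 g).mp g.2
      rw [mem_levelSubgroup]
      cases hv : v (θ ((g : levelSubgroup v θ α) : G)) with
      | top => simp
      | coe n =>
        rw [hv] at this
        norm_cast at *
    · intro g h hgh
      exact Subtype.ext (Subtype.ext
        (congrArg (fun z : levelSubgroup v θ (α + 1) => (z : G)) hgh))
  -- the residual polynomial
  set c := a I * y₀ ^ q ^ I with hc
  have hcv : ∀ i, v (a i * y₀ ^ q ^ i) = v (a i) + ((q ^ i * α : ℤ) : WithTop ℤ) := by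
    intro i
    rw [v.map_mul, DrinfeldModule.map_pow_eq_coe v hg₀]
    push_cast
    rfl
  have hcm : v c = m := by rw [hc, hcv]; exact h.right_eq
  have hc0 : c ≠ 0 := v.ne_zero_of_eq_coe hcm
  have hdivc : ∀ y, v (y / c) = v y + ((-m : ℤ) : WithTop ℤ) := by
    intro y
    rw [div_eq_mul_inv, v.map_mul, AddValuation.map_inv, hcm]
    rfl
  have hpos : ∀ y, (m : WithTop ℤ) < v y → 0 < v (y / c) := by
    intro y hy
    rw [hdivc]
    cases hv : v y with
    | top => simp
    | coe n =>
      rw [hv] at hy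
      norm_cast at *
      omega
  have hnonneg : ∀ y, (m : WithTop ℤ) ≤ v y → 0 ≤ v (y / c) := by
    intro y hy
    rw [hdivc]
    cases hv : v y with
    | top => simp
    | coe n =>
      rw [hv] at hy
      norm_cast at *
      omega
  let b₀ : ℕ → valRing v := fun i =>
    if hi : i ≤ r then ⟨a i * y₀ ^ q ^ i / c, hnonneg _ (by rw [hcv]; exact h.min_le i hi)⟩ else 0
  have hb₀ : ∀ i ≤ r, (b₀ i : L) = a i * y₀ ^ q ^ i / c := fun i hi => by
    simp only [b₀, dif_pos hi]
  let b : ℕ → IsLocalRing.ResidueField (valRing v) := fun i => IsLocalRing.residue _ (b₀ i)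
  have hb0 : ∀ i ≤ r, (i < J ∨ I < i) → b i = 0 := by
    intro i hi hi'
    rw [residue_valRing_eq_zero_iff, hb₀ i hi]
    apply hpos
    rw [hcv]
    exact hi'.elim (h.lt_of_lt i hi) (h.lt_of_gt i hi)
  have hbI : b I = 1 := by
    have : b₀ I = 1 := by
      ext
      rw [hb₀ I h.le_r, ← hc, div_self hc0]
      rfl
    simp only [b, this, map_one]
  have hroot : ∀ g, ∑ i ∈ Finset.range (r + 1), b i * ρ g ^ q ^ i = 0 := by
    intro g
    by_cases hg : ρ g = 0
    · refine Finset.sum_eq_zero fun i _ => ?_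
      rw [hg, zero_pow (by positivity), mul_zero]
    · have hgα : v (θ g) = α := by
        rw [hρ0] at hg
        exact le_antisymm (not_lt.mp hg) g.2
      have hs : ∑ i ∈ Finset.range (r + 1), b i * ρ g ^ q ^ i =
          IsLocalRing.residue _ (∑ i ∈ Finset.range (r + 1),
            b₀ i * ⟨θ g / y₀, hmem g g.2⟩ ^ q ^ i) := by
        rw [map_sum]
        refine Finset.sum_congr rfl fun i _ => ?_
        rw [map_mul, map_pow, hρ]
      rw [hs, residue_valRing_eq_zero_iff]
      have hval : ((∑ i ∈ Finset.range (r + 1),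
            b₀ i * (⟨θ g / y₀, hmem g g.2⟩ : valRing v) ^ q ^ i : valRing v) : L) =
          (∑ i ∈ Finset.range (r + 1), a i * θ g ^ q ^ i) / c := by
        rw [Finset.sum_div, AddSubmonoidClass.coe_finsetSum]
        refine Finset.sum_congr rfl fun i hi => ?_
        rw [MulMemClass.coe_mul, SubmonoidClass.coe_pow,
          hb₀ i (Nat.lt_succ_iff.mp (Finset.mem_range.mp hi))]
        rw [div_pow]
        field_simp
      rw [hval]
      exact hpos _ (hcancel g hgα)
  -- Every surviving exponent is divisible by q^J. Dividing them by q^J gives degree q^(I - J), at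
  -- the cost of evaluating at q^J-th powers, which is harmless since Frobenius is injective.
  set P : (IsLocalRing.ResidueField (valRing v))[X] :=
    ∑ i ∈ Finset.Icc J I, C (b i) * X ^ q ^ (i - J) with hP
  have hq2 : 2 ≤ q := hp.two_le.trans (Nat.le_self_pow he p)
  have hPcoeff : P.coeff (q ^ (I - J)) = 1 := by
    rw [hP, finsetSum_coeff, Finset.sum_eq_single I]
    · simp [hbI]
    · intro i hi hne
      rw [coeff_C_mul_X_pow, if_neg]
      intro h'
      have := Nat.pow_right_injective hq2 h'
      have := Finset.mem_Icc.mp hi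
      have := h.le
      omega
    · intro hI
      exact absurd (Finset.mem_Icc.mpr ⟨h.le, le_rfl⟩) hI
  have hP0 : P ≠ 0 := by
    intro h0
    rw [h0] at hPcoeff
    simp at hPcoeff
  have hPdeg : P.natDegree ≤ q ^ (I - J) := by
    refine natDegree_sum_le_of_forall_le _ _ fun i hi => ?_
    refine (natDegree_C_mul_X_pow_le _ _).trans ?_
    have := Finset.mem_Icc.mp hi
    exact Nat.pow_le_pow_right hqpos (by omega)
  have hProot : ∀ g, P.IsRoot (ρ g ^ q ^ J) := by
    intro g
    rw [IsRoot.def, hP, eval_finsetSum]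
    simp only [eval_mul, eval_C, eval_pow, eval_X]
    rw [← hroot g]
    have hsub : Finset.Icc J I ⊆ Finset.range (r + 1) := by
      intro i hi
      have := Finset.mem_Icc.mp hi
      have := h.le_r
      exact Finset.mem_range.mpr (by omega)
    rw [← Finset.sum_subset hsub]
    · refine Finset.sum_congr rfl fun i hi => ?_
      have := Finset.mem_Icc.mp hi
      rw [← pow_mul, ← pow_add]
      congr 3
      omega
    · intro i hi hi'
      rw [hb0 i (Nat.lt_succ_iff.mp (Finset.mem_range.mp hi)), zero_mul]
      simp only [Finset.mem_Icc, not_and_or, not_le] at hi'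
      exact hi'
  have hchar : CharP (valRing v) p :=
    (valRing v).toSubring.subtype.charP Subtype.val_injective p
  have hchar' : CharP (IsLocalRing.ResidueField (valRing v)) p :=
    CharP.of_ringHom_of_ne_zero (IsLocalRing.residue (valRing v)) p hp.ne_zero
  have hrange : Nat.card ρ.range ≤ q ^ (I - J) := by
    have hinj : Function.Injective (fun z : ρ.range =>
        (⟨(z : IsLocalRing.ResidueField (valRing v)) ^ q ^ J, by
          obtain ⟨g, hg⟩ := z.2
          rw [← hg, Multiset.mem_toFinset, mem_roots hP0]
          exact hProot g⟩ : P.roots.toFinset)) := by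
      intro z w hzw
      simp only [Subtype.mk.injEq] at hzw
      rw [← sub_eq_zero, hq, ← pow_mul, ← sub_pow_char_pow] at hzw
      exact Subtype.ext (sub_eq_zero.mp (eq_zero_of_pow_eq_zero hzw))
    refine (Nat.card_le_card_of_injective _ hinj).trans ?_
    rw [Nat.card_eq_fintype_card, Fintype.card_coe]
    exact (Multiset.toFinset_card_le _).trans ((card_roots' P).trans hPdeg)
  calc Nat.card (levelSubgroup v θ α) = Nat.card ρ.ker * ρ.ker.index :=
        (AddSubgroup.card_mul_index _).symm
    _ = Nat.card ρ.ker * Nat.card ρ.range := by rw [AddSubgroup.index_ker]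
    _ ≤ _ := Nat.mul_le_mul hker hrange

/-- If all the elements of `G` of valuation at most `β` cancel in the monic linearized polynomial
`∑ i ∈ range (r + 1), a i * X ^ q ^ i`, then the elements of valuation larger than `β` form a
subgroup of index at most `q ^ r`. -/
theorem card_le_card_levelSubgroup {p e : ℕ} [CharP L p] [Fact p.Prime] (he : e ≠ 0) {r : ℕ}
    {a : ℕ → L} (har : a r ≠ 0) (β : ℤ)
    (hcancel : ∀ g, v (θ g) ≤ (β : WithTop ℤ) → ∃ i ≤ r, v (a i * θ g ^ (p ^ e) ^ i) <
      v (∑ i ∈ Finset.range (r + 1), a i * θ g ^ (p ^ e) ^ i)) :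
    Nat.card G ≤ Nat.card (levelSubgroup v θ (β + 1)) * (p ^ e) ^ r := by
  have hp : p.Prime := Fact.out
  set q := p ^ e with hq
  have hq2 : 2 ≤ q := hp.two_le.trans (Nat.le_self_pow he p)
  have hlayer : ∀ (α : ℤ) (J I : ℕ) (m : ℤ), α ≤ β → IsMinimalRange v q r a α J I m →
      Nat.card (levelSubgroup v θ α) ≤
      Nat.card (levelSubgroup v θ (α + 1)) * q ^ (I - J) := by
    intro α J I m hα h
    refine card_levelSubgroup_le v θ he h fun g hg => ?_
    obtain ⟨i, hi, hlt⟩ := hcancel g (by rw [hg]; exact_mod_cast hα)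
    refine lt_of_le_of_lt ?_ hlt
    rw [v.map_mul, DrinfeldModule.map_pow_eq_coe v hg]
    exact_mod_cast h.min_le i hi
  -- The factors q^(I - J) of consecutive levels telescope, because the I of level α + 1 is at most
  -- the J of level α.
  have hchain : ∀ (n : ℕ) (J I : ℕ) (m : ℤ), IsMinimalRange v q r a (β - n) J I m →
      Nat.card (levelSubgroup v θ (β - n)) ≤
      Nat.card (levelSubgroup v θ (β + 1)) * q ^ I := by
    intro n
    induction n with
    | zero =>
      intro J I m h
      refine (hlayer _ J I m (by simp) h).trans ?_
      simp only [Nat.cast_zero, sub_zero]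
      exact Nat.mul_le_mul_left _ (Nat.pow_le_pow_right (by omega) (Nat.sub_le _ _))
    | succ n ih =>
      intro J I m h
      obtain ⟨J', I', m', h'⟩ := exists_isMinimalRange v q har (β - n)
      have heq : β - ((n + 1 : ℕ) : ℤ) + 1 = β - n := by push_cast; ring
      have hle := h.le_of_succ hq2 (by rw [heq]; exact h')
      have h1 := hlayer _ J I m (by push_cast; linarith) h
      rw [heq] at h1
      refine h1.trans ((Nat.mul_le_mul_right _ (ih J' I' m' h')).trans ?_)
      rw [mul_assoc, ← pow_add]
      have := h.le
      exact Nat.mul_le_mul_left _ (Nat.pow_le_pow_right (by omega) (by omega))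
  -- G is finite, so below its least truncated valuation the level subgroup is everything and the
  -- chain may start there.
  obtain ⟨g₁, hg₁⟩ := Finite.exists_min (fun g => DrinfeldModule.vTilde v (θ g))
  set n := (β - DrinfeldModule.vTilde v (θ g₁)).toNat
  have htop : levelSubgroup v θ (β - n) = ⊤ := by
    rw [eq_top_iff]
    intro g _
    rw [mem_levelSubgroup]
    refine le_trans ?_ (DrinfeldModule.coe_vTilde_le v _)
    norm_cast
    have := hg₁ g
    have := Int.self_le_toNat (β - DrinfeldModule.vTilde v (θ g₁))
    simp only [n]
    linarith
  obtain ⟨J, I, m, h⟩ := exists_isMinimalRange v q har (β - n)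
  have h1 := hchain n J I m h
  rw [htop, AddSubgroup.card_top] at h1
  exact h1.trans (Nat.mul_le_mul_left _ (Nat.pow_le_pow_right (by omega) h.le_r))

end counting

/-! ### Degrees of Drinfeld modules -/

/-- A relation between a and b must survive the specialization a ↦ z. If z is algebraic, the full
power of its minimal polynomial is divided out of the relation; this is allowed because a is
transcendental. -/
theorem Polynomial.exists_eval₂_eq_zero_and_map_ne_zero {k B E : Type*}
    [Field k] [CommRing B]
    [IsDomain B] [Algebra k B] [Field E] [Algebra k E] {a b : B} (ha : Transcendental k a)
    (z : E) {P : k[X][X]} (hP : P ≠ 0) (h : P.eval₂ (aeval a : k[X] →ₐ[k] B).toRingHom b = 0) :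
    ∃ P' : k[X][X], P'.eval₂ (aeval a : k[X] →ₐ[k] B).toRingHom b = 0 ∧
      P'.map (aeval z : k[X] →ₐ[k] E).toRingHom ≠ 0 := by
  by_cases hz : minpoly k z = 0
  · refine ⟨P, h, fun h0 => hP ?_⟩
    ext1 n
    have h1 := congrArg (fun R => coeff R n) h0
    simp only [coeff_map, coeff_zero] at h1
    have h2 := minpoly.dvd k z h1
    rw [hz] at h2
    simpa using zero_dvd_iff.mp h2
  · have hu : ¬ IsUnit (C (minpoly k z)) := by
      rw [isUnit_C]
      exact minpoly.not_isUnit k z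
    obtain ⟨P', hP', hdvd⟩ :=
      (FiniteMultiplicity.of_not_isUnit hu hP).exists_eq_pow_mul_and_not_dvd
    refine ⟨P', ?_, fun h0 => hdvd ?_⟩
    · rw [hP', eval₂_mul, eval₂_pow, eval₂_C] at h
      refine (mul_eq_zero.mp h).resolve_left (pow_ne_zero _ fun h0 => hz ?_)
      exact (transcendental_iff.mp ha) _ h0
    · rw [C_dvd_iff_dvd_coeff]
      intro n
      have h1 := congrArg (fun R => coeff R n) h0
      simp only [coeff_map, coeff_zero] at h1
      exact minpoly.dvd k z h1

namespace DrinfeldModule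

variable {k A K : Type*} [Field k] [Fintype k] [CommRing A] [Algebra k A] [Field K] [Algebra k K]
  (D : DrinfeldModule k A K)

theorem φ_zero : D.φ 0 = 0 := by
  have := D.map_algebraMap 0
  simpa using this

theorem φ_smul (c : k) (a : A) : D.φ (c • a) = C (algebraMap k K c) * D.φ a := by
  rw [Algebra.smul_def, D.map_mul, D.map_algebraMap]
  simp

/-- `φ` as an additive morphism. -/
def φHom : A →+ K[X] where
  toFun := D.φ
  map_zero' := D.φ_zero
  map_add' := D.map_add

theorem φ_sum {ι : Type*} (s : Finset ι) (u : ι → A) :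
    D.φ (∑ i ∈ s, u i) = ∑ i ∈ s, D.φ (u i) :=
  map_sum D.φHom u s

theorem φ_eq_C_mul_X {a : A} (ha : (D.φ a).natDegree ≤ 1) : D.φ a = C (D.i a) * X := by
  ext j
  rw [coeff_C_mul, coeff_X]
  rcases eq_or_ne 1 j with rfl | hj
  · rw [D.coeff_one, if_pos rfl, mul_one]
  · rw [if_neg hj, mul_zero]
    by_contra h
    obtain ⟨i, rfl⟩ := D.linearized a j (mem_support_iff.mpr h)
    have h1 := le_natDegree_of_ne_zero h
    have h2 : 0 < Fintype.card k ^ i := pow_pos Fintype.card_pos i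
    omega

theorem φ_aeval_eq_C_mul_X {a : A} (ha : (D.φ a).natDegree ≤ 1) (p : k[X]) :
    D.φ (aeval a p) = C (aeval (D.i a) p) * X := by
  induction p using Polynomial.induction_on' with
  | add p q hp hq => rw [_root_.map_add, D.map_add, hp, hq, _root_.map_add, C_add, add_mul]
  | monomial n c =>
    rw [aeval_monomial, ← Algebra.smul_def, φ_smul, aeval_monomial]
    have hpow : D.φ (a ^ n) = C (D.i a ^ n) * X := by
      rw [φ_eq_C_mul_X, _root_.map_pow]
      rw [natDegree_φ_pow]
      exact pow_le_one' ha n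
    rw [hpow, C_mul, mul_assoc]

theorem φ_mul_of_natDegree_le {a : A} (ha : (D.φ a).natDegree ≤ 1) (p : k[X]) (b : A) :
    D.φ (aeval a p * b) = C (aeval (D.i a) p) * D.φ b := by
  rw [D.map_mul, φ_aeval_eq_C_mul_X D ha]
  simp

theorem exists_two_le_natDegree : ∃ b, 2 ≤ (D.φ b).natDegree := by
  obtain ⟨b, hb⟩ := D.nontrivial
  refine ⟨b, ?_⟩
  by_contra h
  exact hb (D.φ_eq_C_mul_X (by omega))

/-- If φ_a were the scalar i(a), choose b with deg φ_b ≥ 2 and a relation between b and a that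
survives a ↦ i(a). Applying φ gives a linear relation between the φ_{b^n}, which is impossible as
their degrees are distinct. -/
theorem two_le_natDegree [IsDomain A] {a : A} (ha : Transcendental k a)
    (hdep : ∀ b : A, ∃ P : k[X][X], P ≠ 0 ∧ P.eval₂ (aeval a : k[X] →ₐ[k] A).toRingHom b = 0) :
    2 ≤ (D.φ a).natDegree := by
  by_contra hlt
  have hle : (D.φ a).natDegree ≤ 1 := by omega
  obtain ⟨b, hb⟩ := D.exists_two_le_natDegree
  obtain ⟨P₀, hP₀, hP₀b⟩ := hdep b
  obtain ⟨P, hPb, hP⟩ := exists_eval₂_eq_zero_and_map_ne_zero ha (D.i a) hP₀ hP₀b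
  set R := P.map (aeval (D.i a) : k[X] →ₐ[k] K).toRingHom with hR
  have hRc : ∀ n, R.coeff n = aeval (D.i a) (P.coeff n) := fun n => by rw [hR, coeff_map]; rfl
  have h0 := congrArg D.φ hPb
  rw [eval₂_eq_sum_range, φ_zero, φ_sum] at h0
  -- Only the top surviving power of b reaches this degree.
  have h1 := congrArg (fun S => coeff S ((D.φ b).natDegree ^ R.natDegree)) h0
  simp only [finsetSum_coeff, coeff_zero] at h1
  rw [Finset.sum_eq_single R.natDegree] at h1
  · have h2 := D.φ_mul_of_natDegree_le hle (P.coeff R.natDegree) (b ^ R.natDegree)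
    have h3 : (aeval a : k[X] →ₐ[k] A).toRingHom (P.coeff R.natDegree) =
      aeval a (P.coeff R.natDegree) := rfl
    rw [h3, h2, coeff_C_mul, ← hRc, ← natDegree_φ_pow] at h1
    rcases mul_eq_zero.mp h1 with h4 | h4
    · exact hP (leadingCoeff_eq_zero.mp h4)
    · have h5 := leadingCoeff_eq_zero.mp h4
      have h6 := D.natDegree_φ_pow b R.natDegree
      rw [h5, natDegree_zero] at h6
      have : 0 < (D.φ b).natDegree ^ R.natDegree := by positivity
      omega
  · intro n _ hn
    have h3 : (aeval a : k[X] →ₐ[k] A).toRingHom (P.coeff n) = aeval a (P.coeff n) := rfl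
    rw [h3, D.φ_mul_of_natDegree_le hle, coeff_C_mul, ← hRc]
    rcases lt_or_gt_of_ne hn with hlt' | hgt
    · rw [coeff_eq_zero_of_natDegree_lt (p := D.φ (b ^ n)), mul_zero]
      rw [natDegree_φ_pow]
      exact Nat.pow_lt_pow_right hb hlt'
    · rw [coeff_eq_zero_of_natDegree_lt hgt, zero_mul]
  · intro hn
    have h3 : R.natDegree ≤ P.natDegree := natDegree_map_le
    exact absurd (Finset.mem_range.mpr (by omega)) hn

/-- A nonconstant a has deg φ_a ≥ 2. A nonzero a algebraic over k is a unit of A, so φ_a has a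
compositional inverse. -/
theorem φ_ne_zero [IsDomain A]
    (hdep : ∀ a b : A, Transcendental k a →
      ∃ P : k[X][X], P ≠ 0 ∧ P.eval₂ (aeval a : k[X] →ₐ[k] A).toRingHom b = 0)
    {a : A} (ha : a ≠ 0) : D.φ a ≠ 0 := by
  intro h
  by_cases hat : Transcendental k a
  · have := D.two_le_natDegree hat (fun b => hdep a b hat)
    rw [h, natDegree_zero] at this
    omega
  · have hint : IsIntegral k a := (not_not.mp hat : IsAlgebraic k a).isIntegral
    obtain ⟨c, hc⟩ := (hint.isUnit ha).exists_right_inv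
    have h1 := D.φ_one
    rw [← hc, D.map_mul, h, zero_comp] at h1
    exact X_ne_zero h1.symm

theorem natDegree_φ_aeval_le {t : A} (ht : 1 ≤ (D.φ t).natDegree) (p : k[X]) :
    (D.φ (aeval t p)).natDegree ≤ (D.φ t).natDegree ^ p.natDegree := by
  rw [aeval_eq_sum_range, φ_sum]
  refine natDegree_sum_le_of_forall_le _ _ fun j hj => ?_
  rw [φ_smul]
  refine (natDegree_C_mul_le _ _).trans ?_
  rw [natDegree_φ_pow]
  exact Nat.pow_le_pow_right ht (Nat.lt_succ_iff.mp (Finset.mem_range.mp hj))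

theorem aeval_φ_eq_sum {L : Type*} [Field L] [Algebra K L] (t : A) {r : ℕ}
    (hr : (D.φ t).natDegree = Fintype.card k ^ r) (y : L) :
    aeval y (D.φ t) = ∑ i ∈ Finset.range (r + 1),
      algebraMap K L ((D.φ t).coeff (Fintype.card k ^ i)) * y ^ Fintype.card k ^ i := by
  have hq : 1 < Fintype.card k := Fintype.one_lt_card
  rw [aeval_eq_sum_range' (n := Fintype.card k ^ r + 1) (by omega)]
  simp only [Algebra.smul_def]
  rw [← Finset.sum_image (s := Finset.range (r + 1)) (g := fun i => Fintype.card k ^ i)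
    (f := fun j => algebraMap K L ((D.φ t).coeff j) * y ^ j)
    (fun i _ j _ h => Nat.pow_right_injective hq h)]
  symm
  apply Finset.sum_subset
  · intro j hj
    obtain ⟨i, hi, rfl⟩ := Finset.mem_image.mp hj
    rw [Finset.mem_range] at *
    have := Nat.pow_le_pow_right (n := Fintype.card k) (by omega) (Nat.lt_succ_iff.mp hi)
    omega
  · intro j _ hj
    have : (D.φ t).coeff j = 0 := by
      by_contra h
      obtain ⟨i, rfl⟩ := D.linearized t j (mem_support_iff.mpr h)
      have h1 := le_natDegree_of_ne_zero h
      rw [hr] at h1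
      have h2 := (Nat.pow_le_pow_iff_right hq).mp h1
      exact hj (Finset.mem_image.mpr ⟨i, Finset.mem_range.mpr (by omega), rfl⟩)
    rw [this, _root_.map_zero, zero_mul]

end DrinfeldModule

/-- Over a function field of one variable any two elements are algebraically dependent. -/
theorem exists_eval₂_eq_zero_of_trdeg_eq_one {k Q : Type*} [Field k] [Field Q] [Algebra k Q]
    (hQ : Algebra.trdeg k Q = 1) (A : Subalgebra k Q) (a b : A) (ha : Transcendental k a) :
    ∃ P : k[X][X], P ≠ 0 ∧ P.eval₂ (aeval a : k[X] →ₐ[k] A).toRingHom b = 0 := by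
  have hat : Transcendental k (a : Q) := by
    rw [transcendental_iff] at *
    intro p hp
    apply ha
    have : ((aeval a p : A) : Q) = 0 := by rw [← hp, ← Subalgebra.aeval_coe]
    exact_mod_cast this
  have hind : AlgebraicIndependent k (fun _ : Unit => (a : Q)) :=
    algebraicIndependent_unique_type_iff.mpr hat
  have hbasis := hind.isTranscendenceBasis_of_lift_trdeg_le_of_finite (by simp [hQ])
  have halg := hbasis.isAlgebraic
  rw [Set.range_const] at halg
  obtain ⟨P, hP, hPb⟩ := halg.isAlgebraic (b : Q)
  let ψ : k[X] →+* Algebra.adjoin k {(a : Q)} :=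
    ((aeval (⟨a, Algebra.self_mem_adjoin_singleton k _⟩ : Algebra.adjoin k {(a : Q)})) :
      k[X] →ₐ[k] Algebra.adjoin k {(a : Q)}).toRingHom
  have hψ : Function.Surjective ψ := by
    rintro ⟨y, hy⟩
    obtain ⟨p, hp⟩ := (Algebra.adjoin_singleton_eq_range_aeval k (a : Q)).le hy
    refine ⟨p, Subtype.ext ?_⟩
    exact (Subalgebra.aeval_coe _ _ p).symm.trans hp
  obtain ⟨R, hR⟩ := Polynomial.map_surjective ψ hψ P
  refine ⟨R, ?_, ?_⟩
  · rintro rfl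
    exact hP (by rw [← hR, Polynomial.map_zero])
  · apply Subtype.val_injective
    rw [← hR, aeval_def, eval₂_map] at hPb
    have hcomp : (algebraMap (Algebra.adjoin k {(a : Q)}) Q).comp ψ =
        A.val.toRingHom.comp (aeval a : k[X] →ₐ[k] A).toRingHom := by
      refine Polynomial.ringHom_ext (fun c => ?_) ?_
      · simp [ψ]
      · simp [ψ]
    have := hom_eval₂ R (aeval a : k[X] →ₐ[k] A).toRingHom A.val.toRingHom b
    rw [← hcomp] at this
    exact this.trans hPb

/-! ### Good reduction -/

section reduction

variable {L : Type*} [Field L] (v : AddValuation L (WithTop ℤ))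

theorem exists_map_subtype_eq {f : L[X]} (hf : ∀ j, 0 ≤ v (f.coeff j)) :
    ∃ g : (valRing v)[X], g.map (valRing v).subtype = f := by
  have := (Polynomial.lifts_iff_coeff_lifts (f := (valRing v).subtype) f).mpr
    (fun j => ⟨⟨f.coeff j, hf j⟩, rfl⟩)
  exact (Polynomial.mem_lifts f).mp this

/-- Scale g by the inverse of its worst coefficient and reduce modulo the maximal ideal. If that
coefficient were not integral, f ∘ g = g ∘ f would reduce to h^d = 0, although h has a coefficient
equal to 1. -/
theorem valuation_coeff_nonneg_of_comp_comm {f g : L[X]} (hf : f.Monic) (hd : 2 ≤ f.natDegree)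
    (hcomm : f.comp g = g.comp f) (hint : ∀ j, 0 ≤ v (f.coeff j)) (j : ℕ) :
    0 ≤ v (g.coeff j) := by
  by_contra hneg
  push Not at hneg
  have hj : j ∈ g.support := by
    rw [mem_support_iff]
    intro h
    rw [h, v.map_zero] at hneg
    exact not_top_lt hneg
  obtain ⟨l, hl, hmin⟩ := Finset.exists_min_image g.support (fun j => v (g.coeff j)) ⟨j, hj⟩
  set γ := g.coeff l with hγ
  have hγneg : v γ < 0 := (hmin j hj).trans_lt hneg
  have hγ0 : γ ≠ 0 := mem_support_iff.mp hl
  have hinv : ∀ y, v γ ≤ v y → 0 ≤ v (γ⁻¹ * y) := by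
    intro y hy
    obtain ⟨n, hn⟩ := v.exists_eq_coe hγ0
    rw [v.map_mul, AddValuation.map_inv, hn]
    rw [hn] at hy
    have h0 : (-(n : WithTop ℤ)) = ((-n : ℤ) : WithTop ℤ) := rfl
    rw [h0]
    cases hv : v y with
    | top => simp
    | coe m =>
      rw [hv] at hy
      norm_cast at *
      omega
  have hγinv : 0 < v γ⁻¹ := by
    obtain ⟨n, hn⟩ := v.exists_eq_coe hγ0
    have h0 : (-(n : WithTop ℤ)) = ((-n : ℤ) : WithTop ℤ) := rfl
    rw [AddValuation.map_inv, hn, h0]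
    rw [hn] at hγneg
    norm_cast at *
    omega
  obtain ⟨f₀, hf₀⟩ := exists_map_subtype_eq v hint
  obtain ⟨h₀, hh₀⟩ := exists_map_subtype_eq v (f := C γ⁻¹ * g) (by
    intro i
    rw [coeff_C_mul]
    apply hinv
    by_cases hi : i ∈ g.support
    · exact hmin i hi
    · rw [notMem_support_iff.mp hi, v.map_zero]; exact le_top)
  let c : valRing v := ⟨γ⁻¹, hγinv.le⟩
  have hc : (valRing v).subtype c = γ⁻¹ := rfl
  set d := f.natDegree with hdef
  have hinj : Function.Injective (Polynomial.map (valRing v).subtype) :=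
    Polynomial.map_injective _ Subtype.val_injective
  -- The relation f ∘ g = g ∘ f multiplied by γ^(-d), written over the valuation ring. The right
  -- side keeps the factor c^(d - 1), which dies in the residue field because d ≥ 2.
  have key : h₀ ^ d + C c * ∑ i ∈ Finset.range d, C (f₀.coeff i) * C c ^ (d - 1 - i) * h₀ ^ i =
      C c ^ (d - 1) * h₀.comp f₀ := by
    apply hinj
    simp only [Polynomial.map_add, Polynomial.map_pow, Polynomial.map_mul, Polynomial.map_sum,
      Polynomial.map_comp, map_C, hh₀, hf₀, hc]
    have h1 : ∀ i, (valRing v).subtype (f₀.coeff i) = f.coeff i := fun i => by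
      rw [← hf₀, coeff_map]
    simp only [h1]
    have h2 : (C γ⁻¹ * g).comp f = C γ⁻¹ * f.comp g := by
      rw [mul_comp, C_comp, hcomm]
    have h3 : f.comp g = g ^ d + ∑ i ∈ Finset.range d, C (f.coeff i) * g ^ i := by
      rw [comp, eval₂_eq_sum_range, Finset.sum_range_succ, ← hdef, hf.coeff_natDegree]
      simp [add_comm]
    rw [h2, h3, ← mul_assoc, ← pow_succ, Nat.sub_add_cancel (by omega), mul_add, mul_pow,
      Finset.mul_sum, Finset.mul_sum]
    congr 1
    refine Finset.sum_congr rfl fun i hi => ?_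
    have hi' := Finset.mem_range.mp hi
    have h4 : (C γ⁻¹ : L[X]) ^ d = C γ⁻¹ * C γ⁻¹ ^ (d - 1 - i) * C γ⁻¹ ^ i := by
      rw [← pow_succ', ← pow_add]
      congr 1
      omega
    rw [h4]
    ring
  have hres := congrArg (Polynomial.map (IsLocalRing.residue (valRing v))) key
  have hcres : IsLocalRing.residue (valRing v) c = 0 :=
    (residue_valRing_eq_zero_iff v c).mpr hγinv
  simp only [Polynomial.map_add, Polynomial.map_pow, Polynomial.map_mul, map_C, hcres, C_0,
    zero_mul, add_zero, zero_pow (show d - 1 ≠ 0 by omega)] at hres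
  have h5 := eq_zero_of_pow_eq_zero hres
  have h6 := congrArg (fun p => coeff p l) h5
  have h7 : h₀.coeff l = 1 := by
    apply Subtype.val_injective
    have h8 := congrArg (fun p => coeff p l) hh₀
    simp only [coeff_map, coeff_C_mul, ← hγ, inv_mul_cancel₀ hγ0] at h8
    exact h8
  simp [coeff_map, h7] at h6

/-- Comparing leading coefficients in f ∘ g = g ∘ f gives l^d = l for the leading coefficient l of
g. -/
theorem valuation_leadingCoeff_of_comp_comm {f g : L[X]} (hf : f.Monic) (hd : 2 ≤ f.natDegree)
    (hcomm : f.comp g = g.comp f) (hg : g.natDegree ≠ 0) : v g.leadingCoeff = 0 := by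
  have h := congrArg leadingCoeff hcomm
  rw [leadingCoeff_comp hg, leadingCoeff_comp (by omega), hf.leadingCoeff, one_pow, one_mul,
    mul_one] at h
  have hg0 : g.leadingCoeff ≠ 0 := by
    intro h0
    rw [leadingCoeff_eq_zero] at h0
    rw [h0] at hg
    simp at hg
  obtain ⟨n, hn⟩ := v.exists_eq_coe hg0
  have h1 := congrArg v h
  rw [DrinfeldModule.map_pow_eq_coe v hn, hn] at h1
  norm_cast at h1
  rw [hn]
  have h2 : ((f.natDegree : ℤ) - 1) * n = 0 := by linarith
  rcases mul_eq_zero.mp h2 with h3 | h3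
  · omega
  · rw [h3]; rfl

end reduction

namespace DrinfeldModule

variable {k A K : Type*} [Field k] [Fintype k] [CommRing A] [Algebra k A] [Field K] [Algebra k K]
  (D : DrinfeldModule k A K)

theorem natDegree_φ_ne_zero {a : A} (ha : D.φ a ≠ 0) : (D.φ a).natDegree ≠ 0 := by
  have h1 := D.linearized a _ (natDegree_mem_support_of_nonzero ha)
  obtain ⟨i, hi⟩ := h1
  rw [hi]
  exact (pow_pos Fintype.card_pos i).ne'

theorem goodReduction_of_coeff_nonneg {L : Type*} [Field L] [Algebra K L]
    (v : AddValuation L (WithTop ℤ)) (hne : ∀ a : A, a ≠ 0 → D.φ a ≠ 0) {t : A}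
    (ht : 2 ≤ (D.φ t).natDegree) (hmonic : (D.φ t).Monic)
    (hint : ∀ j, 0 ≤ v (algebraMap K L ((D.φ t).coeff j))) : D.GoodReduction v := by
  intro a ha
  have hcomm : ((D.φ t).map (algebraMap K L)).comp ((D.φ a).map (algebraMap K L)) =
      ((D.φ a).map (algebraMap K L)).comp ((D.φ t).map (algebraMap K L)) := by
    rw [← Polynomial.map_comp, ← Polynomial.map_comp, ← D.map_mul, ← D.map_mul, mul_comm]
  have hd : 2 ≤ ((D.φ t).map (algebraMap K L)).natDegree := by rwa [natDegree_map]
  constructor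
  · intro j
    have := valuation_coeff_nonneg_of_comp_comm v (hmonic.map _) hd hcomm
      (by simpa using hint) j
    simpa using this
  · have := valuation_leadingCoeff_of_comp_comm v (hmonic.map _) hd hcomm
      (by rw [natDegree_map]; exact D.natDegree_φ_ne_zero (hne a ha))
    rwa [leadingCoeff_map] at this

end DrinfeldModule

/-! ### Discrete valuations and their valuation rings -/

theorem exists_addValuation {L : Type*} [Field L] (u : L → ℤ)
    (hmul : ∀ x y, x ≠ 0 → y ≠ 0 → u (x * y) = u x + u y)
    (hadd : ∀ x y, x ≠ 0 → y ≠ 0 → x + y ≠ 0 → min (u x) (u y) ≤ u (x + y)) :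
    ∃ v : AddValuation L (WithTop ℤ), ∀ x, x ≠ 0 → v x = (u x : WithTop ℤ) := by
  classical
  refine ⟨AddValuation.of (fun x => if x = 0 then ⊤ else (u x : WithTop ℤ)) (by simp) ?_ ?_ ?_, ?_⟩
  · have := hmul 1 1 one_ne_zero one_ne_zero
    rw [mul_one] at this
    rw [if_neg one_ne_zero]
    have h0 : u 1 = 0 := by omega
    rw [h0]; rfl
  · intro x y
    by_cases hx : x = 0
    · simp [hx]
    by_cases hy : y = 0
    · simp [hy]
    by_cases hxy : x + y = 0
    · simp [hxy]
    rw [if_neg hx, if_neg hy, if_neg hxy]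
    exact_mod_cast hadd x y hx hy hxy
  · intro x y
    by_cases hx : x = 0
    · simp [hx]
    by_cases hy : y = 0
    · simp [hy]
    rw [if_neg hx, if_neg hy, if_neg (mul_ne_zero hx hy), hmul x y hx hy]
    rfl
  · intro x hx
    rw [AddValuation.of_apply, if_neg hx]

namespace AddValuation

variable {L : Type*} [Field L]

theorem map_zpow_eq_coe (v : AddValuation L (WithTop ℤ)) {y : L} {e : ℤ}
    (h : v y = (e : WithTop ℤ)) (i : ℤ) : v (y ^ i) = ((i * e : ℤ) : WithTop ℤ) := by
  obtain ⟨n, rfl | rfl⟩ := i.eq_nat_or_neg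
  · rw [zpow_natCast]; exact DrinfeldModule.map_pow_eq_coe v h n
  · rw [zpow_neg, zpow_natCast, AddValuation.map_inv, DrinfeldModule.map_pow_eq_coe v h n, neg_mul]
    rfl

theorem map_div_nonneg_iff (v : AddValuation L (WithTop ℤ)) {x y : L} (hy : y ≠ 0) :
    0 ≤ v (x / y) ↔ v y ≤ v x := by
  obtain ⟨n, hn⟩ := v.exists_eq_coe hy
  have h0 : (-(n : WithTop ℤ)) = ((-n : ℤ) : WithTop ℤ) := rfl
  rw [div_eq_mul_inv, v.map_mul, AddValuation.map_inv, hn, h0]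
  cases v x with
  | top => simp
  | coe m =>
    norm_cast
    omega

/-- The ring determines the units, so w = e · v with e the value of w at a uniformizer of v;
surjectivity of w forces e = 1. -/
theorem eq_of_valRing_eq {v w : AddValuation L (WithTop ℤ)} (hv : Function.Surjective v)
    (hw : Function.Surjective w) (h : valRing v = valRing w) : v = w := by
  have hiff : ∀ y, 0 ≤ v y ↔ 0 ≤ w y := fun y => by rw [← mem_valRing, h, mem_valRing]
  have hiff0 : ∀ y, v y = 0 → w y = 0 := by
    intro y hy
    have h1 : 0 ≤ w y := (hiff y).mp hy.ge
    have h2 : 0 ≤ w y⁻¹ := (hiff _).mp (by rw [AddValuation.map_inv, hy]; simp)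
    have hy0 : y ≠ 0 := by
      rintro rfl
      rw [v.map_zero] at hy
      exact absurd hy (by simp)
    obtain ⟨n, hn⟩ := w.exists_eq_coe hy0
    have h0 : (-(n : WithTop ℤ)) = ((-n : ℤ) : WithTop ℤ) := rfl
    rw [AddValuation.map_inv, hn, h0] at h2
    rw [hn] at h1 ⊢
    norm_cast at *
    omega
  obtain ⟨ϖ, hϖ⟩ := hv ((1 : ℤ) : WithTop ℤ)
  have hϖ0 : ϖ ≠ 0 := v.ne_zero_of_eq_coe hϖ
  obtain ⟨e, he⟩ := w.exists_eq_coe hϖ0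
  have key : ∀ y, y ≠ 0 → ∀ n : ℤ, v y = n → w y = ((n * e : ℤ) : WithTop ℤ) := by
    intro y hy n hn
    have h1 : v (y * ϖ ^ (-n)) = 0 := by
      rw [v.map_mul, map_zpow_eq_coe v hϖ, hn, ← WithTop.coe_add]
      simp
    have h2 := hiff0 _ h1
    rw [w.map_mul, map_zpow_eq_coe w he] at h2
    obtain ⟨m, hm⟩ := w.exists_eq_coe hy
    rw [hm, ← WithTop.coe_add] at h2
    rw [hm]
    have h3 : m + -n * e = 0 := by exact_mod_cast h2
    exact_mod_cast (by linarith : m = n * e)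
  have he1 : e = 1 := by
    have hepos : 0 ≤ e := by
      have := (hiff ϖ).mp (by rw [hϖ]; exact_mod_cast zero_le_one)
      rw [he] at this
      exact_mod_cast this
    obtain ⟨z, hz⟩ := hw ((1 : ℤ) : WithTop ℤ)
    have hz0 : z ≠ 0 := w.ne_zero_of_eq_coe hz
    obtain ⟨n, hn⟩ := v.exists_eq_coe hz0
    have h1 := key z hz0 n hn
    rw [hz] at h1
    have h2 : (1 : ℤ) = n * e := by exact_mod_cast h1
    exact Int.eq_one_of_dvd_one hepos ⟨n, by linarith⟩
  ext y
  by_cases hy : y = 0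
  · rw [hy, v.map_zero, w.map_zero]
  · obtain ⟨n, hn⟩ := v.exists_eq_coe hy
    rw [key y hy n hn, hn, he1, mul_one]

open Classical in
/-- The absolute value `y ↦ 2 ^ (- v y)`. -/
noncomputable def toAbs (v : AddValuation L (WithTop ℤ)) : AbsoluteValue L ℝ where
  toFun y := if y = 0 then 0 else (2⁻¹ : ℝ) ^ (v y).untopD 0
  map_mul' x y := by
    by_cases hx : x = 0
    · simp [hx]
    by_cases hy : y = 0
    · simp [hy]
    obtain ⟨m, hm⟩ := v.exists_eq_coe hx
    obtain ⟨n, hn⟩ := v.exists_eq_coe hy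
    rw [if_neg hx, if_neg hy, if_neg (mul_ne_zero hx hy), v.map_mul, hm, hn, ← WithTop.coe_add,
      WithTop.untopD_coe, WithTop.untopD_coe, WithTop.untopD_coe, zpow_add₀ (by norm_num)]
  nonneg' y := by
    split_ifs
    · exact le_rfl
    · positivity
  eq_zero' y := by
    constructor
    · intro h
      by_contra hy
      rw [if_neg hy] at h
      exact absurd h (zpow_ne_zero _ (by norm_num))
    · intro h
      rw [if_pos h]
  add_le' x y := by
    by_cases hx : x = 0
    · simp [hx]
    by_cases hy : y = 0
    · simp [hy]
    rw [if_neg hx, if_neg hy]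
    by_cases hxy : x + y = 0
    · rw [if_pos hxy]; positivity
    rw [if_neg hxy]
    obtain ⟨m, hm⟩ := v.exists_eq_coe hx
    obtain ⟨n, hn⟩ := v.exists_eq_coe hy
    obtain ⟨s, hs⟩ := v.exists_eq_coe hxy
    have h := v.map_add x y
    rw [hm, hn, hs] at h
    rw [hm, hn, hs, WithTop.untopD_coe, WithTop.untopD_coe, WithTop.untopD_coe]
    have h' : min m n ≤ s := by exact_mod_cast h
    have hanti : ∀ {a b : ℤ}, a ≤ b → (2⁻¹ : ℝ) ^ b ≤ (2⁻¹ : ℝ) ^ a := fun hab =>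
      zpow_le_zpow_right_of_le_one₀ (by norm_num) (by norm_num) hab
    have hpos : ∀ a : ℤ, (0 : ℝ) ≤ (2⁻¹ : ℝ) ^ a := fun a => by positivity
    rcases min_le_iff.mp h' with h1 | h1
    · linarith [hanti h1, hpos n]
    · linarith [hanti h1, hpos m]

open Classical in
theorem toAbs_apply (v : AddValuation L (WithTop ℤ)) {y : L} {n : ℤ} (h : v y = n) :
    v.toAbs y = (2⁻¹ : ℝ) ^ n := by
  change (if y = 0 then 0 else (2⁻¹ : ℝ) ^ (v y).untopD 0) = _
  rw [if_neg (v.ne_zero_of_eq_coe h), h, WithTop.untopD_coe]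

theorem toAbs_le_one_iff (v : AddValuation L (WithTop ℤ)) (y : L) : v.toAbs y ≤ 1 ↔ 0 ≤ v y := by
  by_cases hy : y = 0
  · simp [hy]
  · obtain ⟨n, hn⟩ := v.exists_eq_coe hy
    rw [toAbs_apply v hn, hn, zpow_le_one_iff_right_of_lt_one₀ (by norm_num) (by norm_num)]
    norm_cast

theorem toAbs_lt_one_iff (v : AddValuation L (WithTop ℤ)) (y : L) : v.toAbs y < 1 ↔ 0 < v y := by
  by_cases hy : y = 0
  · simp [hy]
  · obtain ⟨n, hn⟩ := v.exists_eq_coe hy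
    rw [toAbs_apply v hn, hn, zpow_lt_one_iff_right_of_lt_one₀ (by norm_num) (by norm_num)]
    norm_cast

/-- Weak approximation for inequivalent absolute values supplies an element large at i and small
elsewhere. -/
theorem exists_map_eq_zero_and_pos {ι : Type*} [Finite ι] (w : ι → AddValuation L (WithTop ℤ))
    (hw : ∀ i, Function.Surjective (w i)) (hinj : Function.Injective w) (i : ι) :
    ∃ y, w i y = 0 ∧ ∀ j ≠ i, 0 < w j y := by
  obtain ⟨a, hai, haj⟩ := AbsoluteValue.exists_one_lt_lt_one_pi_of_not_isEquiv
    (v := fun i => (w i).toAbs)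
    (fun i => by
      obtain ⟨y, hy⟩ := hw i ((1 : ℤ) : WithTop ℤ)
      refine ⟨y, (w i).ne_zero_of_eq_coe hy, ?_⟩
      rw [toAbs_apply _ hy]
      norm_num)
    (fun i j hij h => hij (hinj (eq_of_valRing_eq (hw i) (hw j) (by
      ext y
      rw [mem_valRing, mem_valRing, ← toAbs_le_one_iff, ← toAbs_le_one_iff]
      have := h y 1
      simpa using this)))) i
  have hi : w i a < 0 := by
    rw [← not_le, ← toAbs_le_one_iff]
    exact not_le.mpr hai
  have hj : ∀ j ≠ i, 0 < w j a := fun j hj => (toAbs_lt_one_iff _ _).mp (haj j hj)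
  have h1 : w i (1 + a) = w i a := by
    rw [(w i).map_add_eq_of_lt_right]
    rwa [(w i).map_one]
  have ha0 : 1 + a ≠ 0 := by
    intro h
    rw [h, (w i).map_zero] at h1
    rw [← h1] at hi
    exact not_top_lt hi
  -- The map a ↦ a / (1 + a) sends large elements to units and leaves the valuation of small ones
  -- unchanged.
  refine ⟨a / (1 + a), ?_, fun j hj' => ?_⟩
  · obtain ⟨n, hn⟩ := (w i).exists_eq_coe ha0
    have h0 : (-(n : WithTop ℤ)) = ((-n : ℤ) : WithTop ℤ) := rfl
    rw [div_eq_mul_inv, (w i).map_mul, AddValuation.map_inv, ← h1, hn, h0, ← WithTop.coe_add]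
    simp
  · have h2 : w j (1 + a) = 0 := by
      rw [(w j).map_add_eq_of_lt_left, (w j).map_one]
      rw [(w j).map_one]
      exact hj j hj'
    rw [div_eq_mul_inv, (w j).map_mul, AddValuation.map_inv, h2]
    simpa using hj j hj'

end AddValuation

/-! ### Places of a finite extension -/

section extension

variable {K₀ L : Type*} [Field K₀] [Field L] [Algebra K₀ L]

theorem LiesOver.nonneg_iff {w : AddValuation L (WithTop ℤ)} {v : AddValuation K₀ (WithTop ℤ)}
    (h : LiesOver w v) (c : K₀) : 0 ≤ w (algebraMap K₀ L c) ↔ 0 ≤ v c := by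
  rw [← mem_valRing, ← mem_valRing, ← h, ValuationSubring.mem_comap]

/-- Elements that are units at one place above v and small at the others are linearly independent
over K₀, so there are at most [L : K₀] places above v. -/
theorem finite_setOf_liesOver [FiniteDimensional K₀ L] (v : AddValuation K₀ (WithTop ℤ)) :
    {w : AddValuation L (WithTop ℤ) | Function.Surjective w ∧ LiesOver w v}.Finite := by
  classical
  by_contra hinf
  obtain ⟨T, hT, hcard⟩ := Set.Infinite.exists_subset_card_eq hinf (Module.finrank K₀ L + 1)
  have hTs : ∀ w : T, Function.Surjective (w : AddValuation L (WithTop ℤ)) ∧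
      LiesOver (w : AddValuation L (WithTop ℤ)) v := fun w => hT w.2
  choose y hy0 hypos using AddValuation.exists_map_eq_zero_and_pos
    (fun w : T => (w : AddValuation L (WithTop ℤ))) (fun w => (hTs w).1) Subtype.val_injective
  have hlin : LinearIndependent K₀ y := by
    rw [Fintype.linearIndependent_iff]
    intro c hc
    by_contra hne
    push Not at hne
    obtain ⟨i₁, hi₁⟩ := hne
    obtain ⟨l, -, hmin⟩ := Finset.exists_min_image Finset.univ (fun i => v (c i)) ⟨i₁, by simp⟩
    have hl : c l ≠ 0 := by
      intro h0
      have := hmin i₁ (by simp)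
      rw [h0, v.map_zero, top_le_iff, v.top_iff] at this
      exact hi₁ this
    have hsum : ∑ i, algebraMap K₀ L (c i / c l) * y i = 0 := by
      have : ∑ i, algebraMap K₀ L (c i / c l) * y i = (c l)⁻¹ • ∑ i, c i • y i := by
        rw [Finset.smul_sum]
        refine Finset.sum_congr rfl fun i _ => ?_
        rw [smul_smul, Algebra.smul_def, div_eq_inv_mul]
      rw [this, hc, smul_zero]
    rw [← Finset.add_sum_erase _ _ (Finset.mem_univ l), div_self hl, map_one, one_mul] at hsum
    obtain ⟨w, hw⟩ : ∃ w : AddValuation L (WithTop ℤ), w = l.1 := ⟨_, rfl⟩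
    have hpos : 0 < w (∑ i ∈ Finset.univ.erase l, algebraMap K₀ L (c i / c l) * y i) := by
      refine w.map_lt_sum (by simp) fun i hi => ?_
      rw [w.map_mul]
      refine lt_of_lt_of_le (b := w (y i))
        (by rw [hw]; exact hypos i l (Finset.ne_of_mem_erase hi).symm) (le_add_of_nonneg_left ?_)
      rw [hw, (hTs l).2.nonneg_iff, v.map_div_nonneg_iff hl]
      exact hmin i (by simp)
    rw [eq_neg_of_add_eq_zero_right hsum, w.map_neg, hw, hy0 l] at hpos
    exact lt_irrefl _ hpos
  have := hlin.fintype_card_le_finrank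
  rw [Fintype.card_coe, hcard] at this
  omega

/-- `Module.finrank` is 0 for an infinite extension, so the content is finiteness: lifts of
independent residues stay independent over K₀. -/
theorem relDegree_pos [FiniteDimensional K₀ L] (w : AddValuation L (WithTop ℤ)) :
    0 < relDegree K₀ w := by
  unfold relDegree
  set W := valRing w
  let _ := (IsLocalRing.ResidueField.map (traceHom K₀ W)).toAlgebra
  have hmap : ∀ c : W.comap (algebraMap K₀ L), algebraMap
      (IsLocalRing.ResidueField (W.comap (algebraMap K₀ L))) (IsLocalRing.ResidueField W)
      (IsLocalRing.residue _ c) = IsLocalRing.residue _ (traceHom K₀ W c) := fun c => rfl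
  have hrank : Module.rank (IsLocalRing.ResidueField (W.comap (algebraMap K₀ L)))
      (IsLocalRing.ResidueField W) ≤ Module.finrank K₀ L := by
    refine rank_le fun s hs => ?_
    choose y hy using fun z : s => IsLocalRing.residue_surjective
      (z : IsLocalRing.ResidueField W)
    have hlin : LinearIndependent K₀ (fun z : s => (y z : L)) := by
      rw [Fintype.linearIndependent_iff]
      intro c hc
      by_contra hne
      push Not at hne
      obtain ⟨i₁, hi₁⟩ := hne
      obtain ⟨l, -, hmax⟩ := Finset.exists_max_image Finset.univ
        (fun i => (W.comap (algebraMap K₀ L)).valuation (c i)) ⟨i₁, by simp⟩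
      have hl : c l ≠ 0 := by
        intro h0
        have := hmax i₁ (by simp)
        rw [h0, map_zero, le_zero_iff, map_eq_zero] at this
        exact hi₁ this
      have hmem : ∀ i, c i / c l ∈ W.comap (algebraMap K₀ L) := by
        intro i
        rw [← ValuationSubring.valuation_le_one_iff, map_div₀]
        exact div_le_one_of_le₀ (hmax i (by simp)) zero_le
      have hsum : ∑ i, traceHom K₀ W ⟨c i / c l, hmem i⟩ * y i = 0 := by
        apply Subtype.val_injective
        have : ∑ i, algebraMap K₀ L (c i / c l) * (y i : L) = (c l)⁻¹ • ∑ i, c i • (y i : L) := by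
          rw [Finset.smul_sum]
          refine Finset.sum_congr rfl fun i _ => ?_
          rw [smul_smul, Algebra.smul_def, div_eq_inv_mul]
        rw [hc, smul_zero] at this
        rw [AddSubmonoidClass.coe_finsetSum]
        exact this
      have hres := congrArg (IsLocalRing.residue W) hsum
      rw [map_sum, map_zero] at hres
      simp only [map_mul, hy, ← hmap, ← Algebra.smul_def] at hres
      have h1 := Fintype.linearIndependent_iff.mp hs _ hres l
      have h2 : (⟨c l / c l, hmem l⟩ : W.comap (algebraMap K₀ L)) = 1 :=
        Subtype.ext (div_self hl)
      rw [h2, map_one] at h1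
      exact one_ne_zero h1
    have := hlin.fintype_card_le_finrank
    rwa [Fintype.card_coe] at this
  have hfin : Module.Finite (IsLocalRing.ResidueField (W.comap (algebraMap K₀ L)))
      (IsLocalRing.ResidueField W) :=
    Module.rank_lt_aleph0_iff.mp (hrank.trans_lt (Cardinal.natCast_lt_aleph0))
  exact Module.finrank_pos

end extension

/-! ### Valuation rings of a finite extension and integrality over a discrete valuation ring. -/

section extension

variable {K₀ L : Type*} [Field K₀] [Field L] [Algebra K₀ L]

/-- In a linear relation between 1, y, …, y^n over K₀, with n = [L : K₀], two terms share the
maximal valuation. Their exponents differ by a number between 1 and n, which divides n!. -/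
theorem ValuationSubring.exists_pow_valuation_eq [FiniteDimensional K₀ L] (W : ValuationSubring L)
    {y : L} (hy : y ≠ 0) : ∃ c : K₀, c ≠ 0 ∧
      W.valuation (y ^ (Module.finrank K₀ L).factorial) = W.valuation (algebraMap K₀ L c) := by
  classical
  set n := Module.finrank K₀ L
  have hdep : ¬ LinearIndependent K₀ (fun i : Fin (n + 1) => y ^ (i : ℕ)) := by
    intro h
    have := h.fintype_card_le_finrank
    rw [Fintype.card_fin] at this
    omega
  rw [Fintype.not_linearIndependent_iff] at hdep
  obtain ⟨c, hc, i₀, hi₀⟩ := hdep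
  obtain ⟨i, -, hmax⟩ := Finset.exists_max_image Finset.univ
    (fun i => W.valuation (c i • y ^ (i : ℕ))) ⟨i₀, by simp⟩
  have hne : c i • y ^ (i : ℕ) ≠ 0 := by
    intro h0
    have := hmax i₀ (by simp)
    rw [h0, map_zero, le_zero_iff, map_eq_zero] at this
    exact smul_ne_zero hi₀ (pow_ne_zero _ hy) this
  obtain ⟨j, hji, hj⟩ : ∃ j, j ≠ i ∧
      W.valuation (c j • y ^ (j : ℕ)) = W.valuation (c i • y ^ (i : ℕ)) := by
    by_contra hcon
    push Not at hcon
    rw [← Finset.add_sum_erase _ _ (Finset.mem_univ i)] at hc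
    have hlt : W.valuation (∑ j ∈ Finset.univ.erase i, c j • y ^ (j : ℕ)) <
        W.valuation (c i • y ^ (i : ℕ)) := by
      refine Valuation.map_sum_lt _ ?_ fun j hj => ?_
      · rwa [Ne, map_eq_zero]
      · exact lt_of_le_of_ne (hmax j (by simp)) (hcon j (Finset.ne_of_mem_erase hj))
    rw [eq_neg_of_add_eq_zero_right hc, Valuation.map_neg] at hlt
    exact lt_irrefl _ hlt
  have key : ∀ i j : Fin (n + 1), (j : ℕ) < i →
      W.valuation (c j • y ^ (j : ℕ)) = W.valuation (c i • y ^ (i : ℕ)) → c i ≠ 0 → c j ≠ 0 →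
      ∃ c : K₀, c ≠ 0 ∧ W.valuation (y ^ n.factorial) = W.valuation (algebraMap K₀ L c) := by
    intro i j hlt hval hci hcj
    obtain ⟨s, hs⟩ := Nat.dvd_factorial (m := (i : ℕ) - j) (n := n) (by omega) (by
      have := i.2
      omega)
    refine ⟨(c j / c i) ^ s, pow_ne_zero _ (div_ne_zero hcj hci), ?_⟩
    simp only [hs, pow_mul, map_pow, map_div₀]
    congr 1
    rw [eq_div_iff (by simpa using hci)]
    have h1 : W.valuation (y ^ (j : ℕ)) ≠ 0 := by
      rw [Ne, map_eq_zero]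
      exact pow_ne_zero _ hy
    apply mul_right_cancel₀ h1
    rw [← map_pow]
    rw [Algebra.smul_def, Algebra.smul_def, map_mul, map_mul] at hval
    rw [hval, mul_right_comm, ← map_mul, ← pow_add, Nat.sub_add_cancel hlt.le, mul_comm]
  have hci : c i ≠ 0 := fun h => hne (by rw [h, zero_smul])
  have hcj : c j ≠ 0 := by
    intro h
    rw [h, zero_smul, map_zero] at hj
    exact hne ((map_eq_zero _).mp hj.symm)
  rcases lt_or_gt_of_ne (fun h => hji (Fin.ext h) : (j : ℕ) ≠ i) with h | h
  · exact key i j h hj hci hcj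
  · exact key j i h hj.symm hcj hci

/-- A valuation ring of a finite extension that induces a discrete valuation ring is discrete. -/
theorem exists_addValuation_valRing_eq [FiniteDimensional K₀ L] (W : ValuationSubring L)
    {v : AddValuation K₀ (WithTop ℤ)} (hv : Function.Surjective v)
    (hW : W.comap (algebraMap K₀ L) = valRing v) :
    ∃ w : AddValuation L (WithTop ℤ), Function.Surjective w ∧ valRing w = W := by
  classical
  have hle : ∀ c c' : K₀, c' ≠ 0 → (W.valuation (algebraMap K₀ L c) ≤
      W.valuation (algebraMap K₀ L c') ↔ v c' ≤ v c) := by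
    intro c c' hc'
    rw [← v.map_div_nonneg_iff hc', ← mem_valRing, ← hW, ValuationSubring.mem_comap,
      ← ValuationSubring.valuation_le_one_iff, map_div₀, map_div₀, div_le_one₀]
    rw [zero_lt_iff, Ne, map_eq_zero]
    simpa using hc'
  set N := (Module.finrank K₀ L).factorial with hN
  have hN0 : N ≠ 0 := Nat.factorial_ne_zero _
  -- The unnormalized valuation: u y is the v-value of an element of K₀ equivalent to y^N.
  have hex : ∀ y : L, ∃ n : ℤ, y ≠ 0 → ∃ c : K₀, v c = n ∧
      W.valuation (y ^ N) = W.valuation (algebraMap K₀ L c) := by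
    intro y
    by_cases hy : y = 0
    · exact ⟨0, fun h => absurd hy h⟩
    · obtain ⟨c, hc0, hc⟩ := W.exists_pow_valuation_eq (K₀ := K₀) hy
      obtain ⟨n, hn⟩ := v.exists_eq_coe hc0
      exact ⟨n, fun _ => ⟨c, hn, hc⟩⟩
  choose u hu using hex
  have hule : ∀ x y, x ≠ 0 → y ≠ 0 → (W.valuation x ≤ W.valuation y ↔ u y ≤ u x) := by
    intro x y hx hy
    obtain ⟨c, hc, hcx⟩ := hu x hx
    obtain ⟨c', hc', hcy⟩ := hu y hy
    have h1 := hle c c' (v.ne_zero_of_eq_coe hc')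
    rw [hc, hc', ← hcx, ← hcy, map_pow, map_pow, pow_le_pow_iff_left₀ zero_le zero_le hN0] at h1
    rw [h1]
    norm_cast
  have hueq : ∀ (x : L) (c : K₀) (n : ℤ), x ≠ 0 → v c = n →
      W.valuation (x ^ N) = W.valuation (algebraMap K₀ L c) → u x = n := by
    intro x c n hx hc hcx
    obtain ⟨c', hc', hcx'⟩ := hu x hx
    have h1 := (hle c c' (v.ne_zero_of_eq_coe hc')).mp (by rw [← hcx, ← hcx'])
    have h2 := (hle c' c (v.ne_zero_of_eq_coe hc)).mp (by rw [← hcx, ← hcx'])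
    rw [hc, hc'] at h1 h2
    norm_cast at h1 h2
    omega
  have humul : ∀ x y, x ≠ 0 → y ≠ 0 → u (x * y) = u x + u y := by
    intro x y hx hy
    obtain ⟨c, hc, hcx⟩ := hu x hx
    obtain ⟨c', hc', hcy⟩ := hu y hy
    refine hueq _ (c * c') _ (mul_ne_zero hx hy) (by rw [v.map_mul, hc, hc']; rfl) ?_
    rw [mul_pow, map_mul, hcx, hcy, map_mul, map_mul]
  have huadd : ∀ x y, x ≠ 0 → y ≠ 0 → x + y ≠ 0 → min (u x) (u y) ≤ u (x + y) := by
    intro x y hx hy hxy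
    rcases le_total (W.valuation x) (W.valuation y) with h | h
    · refine (min_le_right _ _).trans ((hule _ _ hxy hy).mp ?_)
      exact (W.valuation.map_add _ _).trans (max_le h le_rfl)
    · refine (min_le_left _ _).trans ((hule _ _ hxy hx).mp ?_)
      exact (W.valuation.map_add _ _).trans (max_le le_rfl h)
  obtain ⟨v', hv'⟩ := exists_addValuation u humul huadd
  -- normalization
  obtain ⟨ϖ, hϖ⟩ := hv ((1 : ℤ) : WithTop ℤ)
  have hϖ0 : algebraMap K₀ L ϖ ≠ 0 := by simpa using v.ne_zero_of_eq_coe hϖ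
  have huϖ : u (algebraMap K₀ L ϖ) = N := by
    refine hueq _ (ϖ ^ N) _ hϖ0 ?_ (by simp only [map_pow])
    rw [DrinfeldModule.map_pow_eq_coe v hϖ]
    simp
  -- The least positive value e generates the value group, and u / e is the normalized valuation.
  have hexpos : ∃ e : ℕ, 0 < e ∧ ∃ y, y ≠ 0 ∧ u y = e :=
    ⟨N, Nat.pos_of_ne_zero hN0, _, hϖ0, huϖ⟩
  set e := Nat.find hexpos with he
  obtain ⟨hepos, z, hz0, hz⟩ := Nat.find_spec hexpos
  rw [← he] at hepos hz
  have hzpow : ∀ m : ℤ, u (z ^ m) = m * e := by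
    intro m
    have h1 := AddValuation.map_zpow_eq_coe v' (hv' z hz0) m
    rw [hv' _ (zpow_ne_zero _ hz0), hz] at h1
    exact_mod_cast h1
  have hdvd : ∀ y, y ≠ 0 → (e : ℤ) ∣ u y := by
    intro y hy
    by_contra hnd
    have hpos : 0 < u y % e :=
      lt_of_le_of_ne (Int.emod_nonneg _ (by omega)) fun h => hnd (Int.dvd_of_emod_eq_zero h.symm)
    have hlt : u y % e < e := Int.emod_lt_of_pos _ (by omega)
    have hval : u (y * z ^ (-(u y / e))) = u y % e := by
      rw [humul _ _ hy (zpow_ne_zero _ hz0), hzpow]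
      have := Int.emod_add_mul_ediv (u y) e
      linarith
    refine Nat.find_min hexpos (m := (u y % e).toNat) ?_ ⟨?_, y * z ^ (-(u y / e)),
      mul_ne_zero hy (zpow_ne_zero _ hz0), ?_⟩
    · rw [← he]; omega
    · omega
    · rw [hval, Int.toNat_of_nonneg hpos.le]
  have hediv : ∀ y, y ≠ 0 → u y = e * (u y / e) := fun y hy =>
    (Int.mul_ediv_cancel' (hdvd y hy)).symm
  have he0 : (0 : ℤ) < e := by exact_mod_cast hepos
  obtain ⟨w, hw⟩ := exists_addValuation (fun y => u y / e)
    (fun x y hx hy => by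
      rw [humul x y hx hy, Int.add_ediv_of_dvd_left (hdvd x hx)])
    (fun x y hx hy hxy => by
      have h1 := huadd x y hx hy hxy
      rcases min_le_iff.mp h1 with h | h
      · exact (min_le_left _ _).trans (Int.ediv_le_ediv he0 h)
      · exact (min_le_right _ _).trans (Int.ediv_le_ediv he0 h))
  refine ⟨w, fun n => ?_, ?_⟩
  · cases n with
    | top => exact ⟨0, w.map_zero⟩
    | coe n =>
      refine ⟨z ^ n, ?_⟩
      rw [hw _ (zpow_ne_zero _ hz0), hzpow, Int.mul_ediv_cancel _ (by omega)]
  · ext y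
    rw [mem_valRing, ← ValuationSubring.valuation_le_one_iff]
    by_cases hy : y = 0
    · simp [hy]
    · have h1 := hule y 1 hy one_ne_zero
      have h2 : u 1 = 0 := by
        have := humul 1 1 one_ne_zero one_ne_zero
        rw [mul_one] at this
        omega
      rw [map_one, h2] at h1
      rw [h1, hw y hy]
      have h3 := hediv y hy
      constructor
      · intro h
        have h' : 0 ≤ u y / e := by exact_mod_cast h
        rw [h3]
        positivity
      · intro h
        have h' : 0 ≤ u y / e := Int.ediv_nonneg h he0.le
        exact_mod_cast h'

/-- The integral closure of the ring of v is the intersection of the valuation rings W containing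
it. Such a W either induces v, hence is a place above v, or contains K₀ and therefore all of L. So y
is integral, and its minimal polynomial has coefficients in the integrally closed ring of v. -/
theorem coeff_minpoly_nonneg [FiniteDimensional K₀ L] {v : AddValuation K₀ (WithTop ℤ)}
    (hv : Function.Surjective v) {y : L}
    (hy : ∀ w : AddValuation L (WithTop ℤ), Function.Surjective w → LiesOver w v → 0 ≤ w y)
    (i : ℕ) : 0 ≤ v ((minpoly K₀ y).coeff i) := by
  let _ : Algebra (valRing v) L := ((algebraMap K₀ L).comp (valRing v).subtype).toAlgebra
  have : IsScalarTower (valRing v) K₀ L := IsScalarTower.of_algebraMap_eq fun _ => rfl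
  have hint : IsIntegral (valRing v) y := by
    set s : Set L := Set.range (algebraMap (valRing v) L) with hs
    have hmem : y ∈ (⨅ V : {V : ValuationSubring L // s ⊆ V.toSubring}, V.1.toSubring) := by
      rw [Subring.mem_iInf]
      rintro ⟨W, hsW⟩
      change y ∈ W
      by_contra hyW
      have hWv : W.comap (algebraMap K₀ L) = valRing v := by
        apply le_antisymm
        · intro z hz
          by_contra hzv
          apply hyW
          rw [ValuationSubring.mem_comap] at hz
          rw [mem_valRing, not_le] at hzv
          -- Powers of an element z of W with v(z) < 0 absorb every denominator.
          have hall : ∀ c : K₀, algebraMap K₀ L c ∈ W := by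
            intro c
            by_cases hc : c = 0
            · rw [hc, map_zero]; exact W.zero_mem
            have hz0 : z ≠ 0 := by
              rintro rfl
              rw [v.map_zero] at hzv
              exact not_top_lt hzv
            obtain ⟨m, hm⟩ := v.exists_eq_coe hc
            obtain ⟨n, hn⟩ := v.exists_eq_coe hz0
            have h1 : 0 ≤ v (c / z ^ m.natAbs) := by
              rw [v.map_div_nonneg_iff (pow_ne_zero _ hz0), hm,
                DrinfeldModule.map_pow_eq_coe v hn]
              rw [hn] at hzv
              norm_cast at *
              have h3 := neg_abs_le m
              have h4 := abs_nonneg m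
              nlinarith
            have h2 : algebraMap K₀ L (c / z ^ m.natAbs) ∈ W :=
              hsW ⟨⟨_, (mem_valRing v _).mpr h1⟩, rfl⟩
            have h3 := W.mul_mem _ _ h2 (pow_mem hz m.natAbs)
            rwa [← map_pow, ← map_mul, div_mul_cancel₀ _ (pow_ne_zero _ hz0)] at h3
          let _ : Algebra K₀ W := ((algebraMap K₀ L).codRestrict W.toSubring hall).toAlgebra
          have : IsScalarTower K₀ W L := IsScalarTower.of_algebraMap_eq fun _ => rfl
          have hyi : IsIntegral W y := (Algebra.IsIntegral.isIntegral (R := K₀) y).tower_top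
          obtain ⟨y', hy'⟩ := IsIntegrallyClosed.isIntegral_iff.mp hyi
          rw [← hy']
          exact y'.2
        · intro c hc
          exact hsW ⟨⟨c, hc⟩, rfl⟩
      obtain ⟨w, hw, hwW⟩ := exists_addValuation_valRing_eq W hv hWv
      have := hy w hw (by rw [LiesOver, hwW, hWv])
      rw [← mem_valRing, hwW] at this
      exact hyW this
    rw [iInf_valuationSubring_superset] at hmem
    have h1 : IsIntegral (Subring.closure s) y := hmem
    obtain ⟨p, hp, hpy⟩ := h1
    have hsub : ∀ z : Subring.closure s, ∃ c : valRing v, algebraMap (valRing v) L c = z := by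
      intro z
      have hle : Subring.closure s ≤ (algebraMap (valRing v) L).range :=
        Subring.closure_le.mpr (by rw [RingHom.coe_range])
      exact hle z.2
    have hlift : p.map (algebraMap (Subring.closure s) L) ∈ lifts (algebraMap (valRing v) L) := by
      rw [lifts_iff_coeff_lifts]
      intro n
      rw [coeff_map]
      obtain ⟨c, hc⟩ := hsub (p.coeff n)
      exact ⟨c, hc⟩
    obtain ⟨p', hp', -, hmon⟩ := lifts_and_natDegree_eq_and_monic hlift (hp.map _)
    refine ⟨p', hmon, ?_⟩
    rw [← eval_map, hp', eval_map]
    exact hpy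
  rw [minpoly.isIntegrallyClosed_eq_field_fractions' K₀ hint, coeff_map]
  exact ((minpoly (valRing v) y).coeff i).2

/-- With integral coefficients, the top term of the minimal polynomial at y would be strictly the
most negative and could not cancel. -/
theorem exists_coeff_minpoly_neg [FiniteDimensional K₀ L] {w : AddValuation L (WithTop ℤ)}
    {v : AddValuation K₀ (WithTop ℤ)} (h : LiesOver w v) {y : L} (hy : w y < 0) :
    ∃ i, v ((minpoly K₀ y).coeff i) < 0 := by
  by_contra hcon
  push Not at hcon
  have hy0 : y ≠ 0 := by
    rintro rfl
    rw [w.map_zero] at hy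
    exact not_top_lt hy
  obtain ⟨n, hn⟩ := w.exists_eq_coe hy0
  have hn0 : n < 0 := by
    rw [hn] at hy
    exact_mod_cast hy
  have hmonic := minpoly.monic (Algebra.IsIntegral.isIntegral (R := K₀) y)
  have h0 := minpoly.aeval K₀ y
  rw [aeval_eq_sum_range, Finset.sum_range_succ, hmonic.coeff_natDegree, one_smul] at h0
  set d := (minpoly K₀ y).natDegree
  have hlt : w (y ^ d) < w (∑ i ∈ Finset.range d, (minpoly K₀ y).coeff i • y ^ i) := by
    rw [DrinfeldModule.map_pow_eq_coe w hn]
    refine w.map_lt_sum WithTop.coe_ne_top fun i hi => ?_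
    rw [Algebra.smul_def, w.map_mul, DrinfeldModule.map_pow_eq_coe w hn]
    have h1 := (h.nonneg_iff ((minpoly K₀ y).coeff i)).mpr (hcon i)
    refine lt_of_lt_of_le ?_ (le_add_of_nonneg_left h1)
    have := Finset.mem_range.mp hi
    have h2 : (i : ℤ) < d := by exact_mod_cast this
    norm_cast
    nlinarith
  rw [eq_neg_of_add_eq_zero_left h0, w.map_neg] at hlt
  exact lt_irrefl _ hlt

end extension

theorem AddValuation.surjective_of_eq_one {L : Type*} [Field L] {v : AddValuation L (WithTop ℤ)}
    {y : L} (hy : v y = ((1 : ℤ) : WithTop ℤ)) : Function.Surjective v := by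
  intro n
  cases n with
  | top => exact ⟨0, v.map_zero⟩
  | coe n => exact ⟨y ^ n, by rw [v.map_zpow_eq_coe hy, mul_one]⟩

/-! ### Valuations of a rational function field -/

theorem exists_addValuation_of_fractions {R K₀ : Type*} [CommRing R] [IsDomain R] [Field K₀]
    (j : R →+* K₀) (hj : Function.Injective j)
    (hgen : ∀ z : K₀, ∃ a b : R, b ≠ 0 ∧ z = j a / j b) (o : R → ℤ)
    (hmul : ∀ a b, a ≠ 0 → b ≠ 0 → o (a * b) = o a + o b)
    (hadd : ∀ a b, a ≠ 0 → b ≠ 0 → a + b ≠ 0 → min (o a) (o b) ≤ o (a + b)) :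
    ∃ v : AddValuation K₀ (WithTop ℤ), ∀ a, a ≠ 0 → v (j a) = (o a : WithTop ℤ) := by
  have hj0 : ∀ {a}, a ≠ 0 → j a ≠ 0 := fun ha => by rwa [map_ne_zero_iff j hj]
  choose num den hden hz using hgen
  have hnum : ∀ z, z ≠ 0 → num z ≠ 0 := by
    intro z hz0 h
    apply hz0
    rw [hz z, h, map_zero, zero_div]
  set u : K₀ → ℤ := fun z => o (num z) - o (den z) with hu
  have hwd : ∀ z a b, a ≠ 0 → b ≠ 0 → z = j a / j b → u z = o a - o b := by
    intro z a b ha hb h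
    have hz0 : z ≠ 0 := by rw [h]; exact div_ne_zero (hj0 ha) (hj0 hb)
    have h1 : num z * b = a * den z := by
      apply hj
      have h2 := hz z
      have h3 : j (num z) / j (den z) = j a / j b := by rw [← h2, ← h]
      rw [div_eq_div_iff (hj0 (hden z)) (hj0 hb)] at h3
      rw [map_mul, map_mul, h3]
    have h2 := congrArg o h1
    rw [hmul _ _ (hnum z hz0) hb, hmul _ _ ha (hden z)] at h2
    simp only [hu]
    omega
  obtain ⟨v, hv⟩ := exists_addValuation u
    (fun x y hx hy => by
      rw [hwd (x * y) (num x * num y) (den x * den y) (mul_ne_zero (hnum x hx) (hnum y hy))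
        (mul_ne_zero (hden x) (hden y)), hmul _ _ (hnum x hx) (hnum y hy),
        hmul _ _ (hden x) (hden y)]
      · simp only [hu]; omega
      · rw [map_mul, map_mul, mul_div_mul_comm, ← hz x, ← hz y])
    (fun x y hx hy hxy => by
      have h1 : x + y = j (num x * den y + num y * den x) / j (den x * den y) := by
        have h2 := hj0 (hden x)
        have h3 := hj0 (hden y)
        conv_lhs => rw [hz x, hz y]
        rw [map_add, map_mul, map_mul, map_mul]
        field_simp
      have h2 : num x * den y + num y * den x ≠ 0 := by
        intro h0
        rw [h0, map_zero, zero_div] at h1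
        exact hxy h1
      rw [hwd _ _ _ h2 (mul_ne_zero (hden x) (hden y)) h1]
      have h3 := hadd _ _ (mul_ne_zero (hnum x hx) (hden y)) (mul_ne_zero (hnum y hy) (hden x)) h2
      rw [hmul _ _ (hnum x hx) (hden y), hmul _ _ (hnum y hy) (hden x)] at h3
      rw [hmul _ _ (hden x) (hden y)]
      simp only [hu]
      omega)
  refine ⟨v, fun a ha => ?_⟩
  rw [hv _ (hj0 ha)]
  rw [hwd (j a) (a * den 1) (den 1) (mul_ne_zero ha (hden 1)) (hden 1), hmul _ _ ha (hden 1),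
    add_sub_cancel_right]
  rw [map_mul, mul_div_cancel_right₀ _ (hj0 (hden 1))]

section rational

variable {F K₀ : Type*} [Field F] [Field K₀] [Algebra F K₀] {n : ℕ} {X : Fin n → K₀}

/-- `K₀` is the field of fractions of the polynomial ring `F[X₁, …, Xₙ]`. -/
structure IsRationalBasis (F : Type*) {K₀ : Type*} [Field F] [Field K₀] [Algebra F K₀] {n : ℕ}
    (X : Fin n → K₀) : Prop where
  algebraicIndependent : AlgebraicIndependent F X
  exists_eq_div : ∀ z : K₀, ∃ a b : MvPolynomial (Fin n) F, b ≠ 0 ∧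
    z = MvPolynomial.aeval X a / MvPolynomial.aeval X b

variable (hX : IsRationalBasis F X)
include hX

theorem IsRationalBasis.aeval_ne_zero {a : MvPolynomial (Fin n) F} (ha : a ≠ 0) :
    MvPolynomial.aeval X a ≠ 0 := by
  intro h
  exact ha ((injective_iff_map_eq_zero _).mp hX.algebraicIndependent a h)

theorem IsRationalBasis.injective : Function.Injective
    (MvPolynomial.aeval X : MvPolynomial (Fin n) F →ₐ[F] K₀).toRingHom :=
  hX.algebraicIndependent

theorem IsRationalBasis.exists_isOrd {P : MvPolynomial (Fin n) F} (hP : Irreducible P) :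
    ∃ v : AddValuation K₀ (WithTop ℤ), IsOrd X P v := by
  have hfin : ∀ {a : MvPolynomial (Fin n) F}, a ≠ 0 → FiniteMultiplicity P a := fun ha =>
    FiniteMultiplicity.of_not_isUnit hP.not_isUnit ha
  exact exists_addValuation_of_fractions (MvPolynomial.aeval X).toRingHom
    hX.injective hX.exists_eq_div (fun a => ((multiplicity P a : ℕ) : ℤ))
    (fun a b ha hb => by
      rw [multiplicity_mul hP.prime (hfin (mul_ne_zero ha hb))]
      push_cast
      rfl)
    (fun a b ha hb hab => by
      have h : min (multiplicity P a) (multiplicity P b) ≤ multiplicity P (a + b) := by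
        apply (hfin hab).le_multiplicity_of_pow_dvd
        exact dvd_add (pow_dvd_of_le_multiplicity (min_le_left _ _))
          (pow_dvd_of_le_multiplicity (min_le_right _ _))
      exact_mod_cast h)

theorem IsRationalBasis.exists_isNegDeg :
    ∃ v : AddValuation K₀ (WithTop ℤ), IsNegDeg F X v :=
  exists_addValuation_of_fractions (R := MvPolynomial (Fin n) F) (MvPolynomial.aeval X).toRingHom
    hX.injective hX.exists_eq_div (fun a => -(a.totalDegree : ℤ))
    (fun a b ha hb => by
      rw [MvPolynomial.totalDegree_mul_of_isDomain ha hb]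
      push_cast
      ring)
    (fun a b ha hb hab => by
      have h := MvPolynomial.totalDegree_add a b
      have h' : (((a + b).totalDegree : ℕ) : ℤ) ≤ max (a.totalDegree : ℤ) (b.totalDegree : ℤ) := by
        exact_mod_cast h
      omega)

theorem IsRationalBasis.ext {v v' : AddValuation K₀ (WithTop ℤ)}
    (h : ∀ a : MvPolynomial (Fin n) F, a ≠ 0 → v (MvPolynomial.aeval X a) =
      v' (MvPolynomial.aeval X a)) : v = v' := by
  ext z
  obtain ⟨a, b, hb, rfl⟩ := hX.exists_eq_div z
  by_cases ha : a = 0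
  · simp [ha]
  · rw [AddValuation.map_div, AddValuation.map_div, h a ha, h b hb]

omit hX in
theorem IsOrd.surjective {P : MvPolynomial (Fin n) F} (hP : Irreducible P)
    {v : AddValuation K₀ (WithTop ℤ)} (hv : IsOrd X P v) : Function.Surjective v := by
  apply AddValuation.surjective_of_eq_one (y := MvPolynomial.aeval X P)
  rw [hv P hP.ne_zero, multiplicity_self]
  rfl

omit hX in
theorem IsNegDeg.surjective {v : AddValuation K₀ (WithTop ℤ)} (hv : IsNegDeg F X v)
    (i : Fin n) : Function.Surjective v := by
  apply AddValuation.surjective_of_eq_one 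
    (y := (MvPolynomial.aeval X (MvPolynomial.X i : MvPolynomial (Fin n) F))⁻¹)
  rw [AddValuation.map_inv, hv _ (MvPolynomial.X_ne_zero i), MvPolynomial.totalDegree_X]
  rfl

/-- A rational function without poles is constant. -/
theorem IsRationalBasis.mem_range_of_nonneg {c : K₀}
    (hc : ∀ v d, IsRatPlace F X v d → Function.Surjective v → 0 ≤ v c) :
    c ∈ (algebraMap F K₀).range := by
  obtain ⟨a, b, hb, rfl⟩ := hX.exists_eq_div c
  by_cases ha : a = 0
  · rw [ha]; simp
  obtain ⟨a', b', s, hrel, rfl, rfl⟩ := UniqueFactorizationMonoid.exists_reduced_factors a ha b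
  have hs : s ≠ 0 := left_ne_zero_of_mul hb
  have hb' : b' ≠ 0 := right_ne_zero_of_mul hb
  have ha' : a' ≠ 0 := right_ne_zero_of_mul ha
  rw [map_mul, map_mul, mul_div_mul_left _ _ (hX.aeval_ne_zero hs)] at hc ⊢
  have hunit : IsUnit b' := by
    by_contra hnu
    obtain ⟨P, hP, hPb⟩ := WfDvdMonoid.exists_irreducible_factor hnu hb'
    obtain ⟨v, hv⟩ := hX.exists_isOrd hP
    have h1 := hc v _ (IsRatPlace.finite P hP v hv) (hv.surjective hP)
    rw [AddValuation.map_div_nonneg_iff _ (hX.aeval_ne_zero hb'), hv a' ha', hv b' hb'] at h1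
    have h2 : multiplicity P b' ≤ multiplicity P a' := by exact_mod_cast h1
    have h3 : ¬ P ∣ a' := fun h => hP.not_isUnit (hrel h hPb)
    rw [multiplicity_eq_zero.mpr h3] at h2
    exact multiplicity_ne_zero.mpr hPb (by omega)
  obtain ⟨β, hβ, rfl⟩ := MvPolynomial.isUnit_iff_eq_C_of_isReduced.mp hunit
  have hdeg : a'.totalDegree = 0 := by
    by_contra hne
    obtain ⟨v, hv⟩ := hX.exists_isNegDeg
    -- With no variables v_∞ is trivial and not surjective, but then every polynomial is constant
    -- already.
    have hn : ∃ _ : Fin n, True := by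
      by_contra hcon
      push Not at hcon
      have : IsEmpty (Fin n) := ⟨fun i => by simpa using hcon i⟩
      rw [MvPolynomial.eq_C_of_isEmpty a'] at hne
      exact hne (MvPolynomial.totalDegree_C _)
    obtain ⟨i, -⟩ := hn
    have h1 := hc v _ (IsRatPlace.infinite v hv) (hv.surjective i)
    rw [AddValuation.map_div_nonneg_iff _ (hX.aeval_ne_zero hb'), hv a' ha', hv _ hb',
      MvPolynomial.totalDegree_C] at h1
    norm_cast at h1
    omega
  rw [MvPolynomial.totalDegree_eq_zero_iff_eq_C] at hdeg
  rw [hdeg]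
  simp only [MvPolynomial.aeval_C]
  exact ⟨MvPolynomial.coeff 0 a' / β, by rw [map_div₀]⟩

/-- A pole is either v_∞ or belongs to an irreducible factor of the denominator, and associated
factors give the same valuation. -/
theorem IsRationalBasis.finite_setOf_neg (c : K₀) :
    {v : AddValuation K₀ (WithTop ℤ) | (∃ d, IsRatPlace F X v d) ∧ v c < 0}.Finite := by
  classical
  obtain ⟨a, b, hb, rfl⟩ := hX.exists_eq_div c
  have hsub : {v : AddValuation K₀ (WithTop ℤ) | (∃ d, IsRatPlace F X v d) ∧
      v (MvPolynomial.aeval X a / MvPolynomial.aeval X b) < 0} ⊆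
      {v | IsNegDeg F X v} ∪
        ⋃ P ∈ (UniqueFactorizationMonoid.factors b).toFinset, {v | IsOrd X P v} := by
    rintro v ⟨⟨d, hvd⟩, hneg⟩
    cases hvd with
    | infinite _ hv => exact Or.inl hv
    | finite P hP _ hv =>
      right
      have ha : a ≠ 0 := by
        rintro rfl
        rw [map_zero, zero_div, v.map_zero] at hneg
        exact not_top_lt hneg
      have hdvd : P ∣ b := by
        by_contra h
        rw [← not_le, AddValuation.map_div_nonneg_iff _ (hX.aeval_ne_zero hb), hv a ha, hv b hb,
          multiplicity_eq_zero.mpr h] at hneg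
        apply hneg
        norm_cast
        omega
      obtain ⟨P', hP', hassoc⟩ := UniqueFactorizationMonoid.exists_mem_factors_of_dvd hb hP hdvd
      simp only [Set.mem_iUnion, Multiset.mem_toFinset]
      refine ⟨P', hP', fun Q hQ => ?_⟩
      rw [hv Q hQ, multiplicity_eq_of_associated_left hassoc]
  refine Set.Finite.subset (Set.Finite.union ?_ (Set.Finite.biUnion (Finset.finite_toSet _) ?_)) hsub
  · exact Set.Subsingleton.finite fun v hv v' hv' => hX.ext fun Q hQ => by rw [hv Q hQ, hv' Q hQ]
  · intro P _
    exact Set.Subsingleton.finite fun v hv v' hv' => hX.ext fun Q hQ => by rw [hv Q hQ, hv' Q hQ]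

/-! ### Integrality at all places -/

variable {L : Type*} [Field L] [Algebra K₀ L] [FiniteDimensional K₀ L]

theorem IsRationalBasis.finite_setOf_places_neg (y : L) : {w ∈ places F X L | w y < 0}.Finite := by
  have hsub : {w ∈ places F X L | w y < 0} ⊆
      ⋃ v ∈ ⋃ i ∈ Finset.range ((minpoly K₀ y).natDegree + 1),
        {v : AddValuation K₀ (WithTop ℤ) | (∃ d, IsRatPlace F X v d) ∧
          v ((minpoly K₀ y).coeff i) < 0},
        {w : AddValuation L (WithTop ℤ) | Function.Surjective w ∧ LiesOver w v} := by
    rintro w ⟨⟨hw, v, d, hvd, hwv⟩, hneg⟩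
    obtain ⟨i, hi⟩ := exists_coeff_minpoly_neg hwv hneg
    have hir : i ∈ Finset.range ((minpoly K₀ y).natDegree + 1) := by
      rw [Finset.mem_range]
      by_contra h
      rw [coeff_eq_zero_of_natDegree_lt (by omega), v.map_zero] at hi
      exact not_top_lt hi
    simp only [Set.mem_iUnion]
    exact ⟨v, ⟨i, hir, ⟨d, hvd⟩, hi⟩, hw, hwv⟩
  refine Set.Finite.subset (Set.Finite.biUnion (Set.Finite.biUnion (Finset.finite_toSet _) ?_) ?_)
    hsub
  · exact fun i _ => hX.finite_setOf_neg _
  · exact fun v _ => finite_setOf_liesOver v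

/-- The coefficients of the minimal polynomial over K₀ are rational functions without poles, hence
lie in F: an element integral at all places is algebraic over F. -/
theorem IsRationalBasis.exists_monic_aeval_eq_zero {y : L} (hy : ∀ w ∈ places F X L, 0 ≤ w y) :
    ∃ p : F[X], p.Monic ∧ aeval y (p.map (algebraMap F K₀)) = 0 := by
  have hmonic := minpoly.monic (Algebra.IsIntegral.isIntegral (R := K₀) y)
  have hlift : minpoly K₀ y ∈ lifts (algebraMap F K₀) := by
    rw [lifts_iff_coeff_lifts]
    intro i
    exact hX.mem_range_of_nonneg fun v d hvd hv =>
      coeff_minpoly_nonneg hv (fun w hw hwv => hy w ⟨hw, v, d, hvd, hwv⟩) i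
  obtain ⟨p, hp, -, hpm⟩ := lifts_and_natDegree_eq_and_monic hlift hmonic
  exact ⟨p, hpm, by rw [hp]; exact minpoly.aeval K₀ y⟩

-- Irreducible polynomials are not constant, so the degree of the place below is at least 1,
-- whichever witness was chosen; the residue degree is positive as well.
omit hX in
theorem placeDegree_pos_and_le {w : AddValuation L (WithTop ℤ)} (hw : w ∈ places F X L) :
    0 < placeDegree F X w ∧ 1 / (Module.finrank K₀ L : ℝ) ≤ placeDegree F X w := by
  obtain ⟨-, v, d, hvd, hwv⟩ := hw
  have hex : ∃ d v, IsRatPlace F X v d ∧ LiesOver w v := ⟨d, v, hvd, hwv⟩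
  obtain ⟨v', hv', -⟩ := hex.choose_spec
  have hd : 1 ≤ hex.choose := by
    generalize hex.choose = d' at hv'
    cases hv' with
    | infinite => exact le_rfl
    | finite P hP =>
      by_contra h
      have h0 : P.totalDegree = 0 := by omega
      rw [MvPolynomial.totalDegree_eq_zero_iff_eq_C] at h0
      apply hP.not_isUnit
      rw [h0]
      refine IsUnit.map _ (isUnit_iff_ne_zero.mpr fun h1 => hP.ne_zero ?_)
      rw [h0, h1, MvPolynomial.C_0]
  have hfr : (0 : ℝ) < Module.finrank K₀ L := by exact_mod_cast Module.finrank_pos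
  have hrel : (1 : ℝ) ≤ relDegree K₀ w := by exact_mod_cast relDegree_pos w
  have hd' : (1 : ℝ) ≤ hex.choose := by exact_mod_cast hd
  have hval : placeDegree F X w =
      (relDegree K₀ w : ℝ) * (hex.choose : ℝ) / (Module.finrank K₀ L : ℝ) := dif_pos hex
  have hge : 1 / (Module.finrank K₀ L : ℝ) ≤ placeDegree F X w := by
    rw [hval]
    gcongr
    nlinarith
  exact ⟨lt_of_lt_of_le (by positivity) hge, hge⟩

end rational

/-! ### Escaping points -/

namespace DrinfeldModule

section escape

variable {L : Type*} [Field L] (v : AddValuation L (WithTop ℤ))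

/-- `z` has negative valuation `e`, and the leading term of the monic linearized polynomial
`X ^ q ^ r + ∑ i < r, c i * X ^ q ^ i` strictly dominates at `z`. -/
def Escapes (q r : ℕ) (c : ℕ → L) (z : L) (e : ℤ) : Prop :=
  e < 0 ∧ v z = (e : WithTop ℤ) ∧ ∀ i < r, ((q ^ r * e - q ^ i * e : ℤ) : WithTop ℤ) < v (c i)

variable {v} {q r : ℕ} {c : ℕ → L} {z : L} {e : ℤ}

/-- The image has the valuation of the leading term, q^r · e ≤ e, and a more negative valuation only
strengthens the domination. -/
theorem Escapes.map (hq : 1 ≤ q) (hc : c r = 1) (h : Escapes v q r c z e) :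
    Escapes v q r c (∑ i ∈ Finset.range (r + 1), c i * z ^ q ^ i) (q ^ r * e) := by
  obtain ⟨he, hz, hi⟩ := h
  have hqr : (1 : ℤ) ≤ q ^ r := by exact_mod_cast Nat.one_le_pow _ _ hq
  have hle : (q : ℤ) ^ r * e ≤ e := by nlinarith
  refine ⟨by linarith, ?_, fun i hir => lt_of_le_of_lt ?_ (hi i hir)⟩
  · have htop : v (z ^ q ^ r) = ((q ^ r * e : ℤ) : WithTop ℤ) := by
      rw [map_pow_eq_coe v hz]; push_cast; rfl
    rw [Finset.sum_range_succ, hc, one_mul, v.map_add_eq_of_lt_right, htop]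
    rw [htop]
    refine v.map_lt_sum WithTop.coe_ne_top fun i hi' => ?_
    have h1 := hi i (Finset.mem_range.mp hi')
    rw [v.map_mul, map_pow_eq_coe v hz]
    cases hv : v (c i) with
    | top => rw [top_add]; exact WithTop.coe_lt_top _
    | coe m =>
      rw [hv] at h1
      norm_cast at *
      push_cast at *
      linarith
  · have h2 : (q : ℤ) ^ i ≤ q ^ r := by exact_mod_cast Nat.pow_le_pow_right hq hir.le
    norm_cast
    push_cast
    nlinarith

theorem escapes_of_integral (hq : 2 ≤ q) (hz : v z = (e : WithTop ℤ)) (he : e < 0)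
    (hint : ∀ i < r, 0 ≤ v (c i)) : Escapes v q r c z e := by
  refine ⟨he, hz, fun i hi => lt_of_lt_of_le ?_ (hint i hi)⟩
  have h2 : (q : ℤ) ^ i < q ^ r := by exact_mod_cast Nat.pow_lt_pow_right hq hi
  norm_cast
  push_cast
  nlinarith

/-- Without cancellation v(f(y)) is at most every v(c_i) + q^i α. Since α ≤ 0 and some c_j has
negative valuation, this is negative enough for f(y) to escape. For α = 0 it only gives v(f(y)) ≤
v(c_i), and a gap q^r - q^i of at least 2 is needed to make the inequality strict. -/
theorem exists_escapes_of_le (hq : 2 ≤ q) {y : L} {α : ℤ}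
    (hy : v y = (α : WithTop ℤ)) (hα : α ≤ 0) (hα' : α = 0 → ∀ i < r, q ^ i + 2 ≤ q ^ r)
    (hbad : ∃ j < r, v (c j) < 0)
    (hle : ∀ i ≤ r, v (∑ i ∈ Finset.range (r + 1), c i * y ^ q ^ i) ≤ v (c i * y ^ q ^ i)) :
    ∃ e, Escapes v q r c (∑ i ∈ Finset.range (r + 1), c i * y ^ q ^ i) e := by
  set f := ∑ i ∈ Finset.range (r + 1), c i * y ^ q ^ i
  have hle' : ∀ i ≤ r, v f ≤ v (c i) + ((q ^ i * α : ℤ) : WithTop ℤ) := by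
    intro i hi
    have := hle i hi
    rw [v.map_mul, map_pow_eq_coe v hy] at this
    exact_mod_cast this
  obtain ⟨j, hjr, hj⟩ := hbad
  have hneg : v f < 0 := by
    refine lt_of_le_of_lt (hle' j hjr.le) (lt_of_le_of_lt ?_ hj)
    have : ((q ^ j * α : ℤ) : WithTop ℤ) ≤ ((0 : ℤ) : WithTop ℤ) := by
      norm_cast
      exact mul_nonpos_of_nonneg_of_nonpos (by positivity) hα
    calc _ ≤ v (c j) + ((0 : ℤ) : WithTop ℤ) := by gcongr
      _ = _ := by simp
  have hf0 : f ≠ 0 := by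
    intro h0
    rw [h0, v.map_zero] at hneg
    exact not_top_lt hneg
  obtain ⟨m, hm⟩ := v.exists_eq_coe hf0
  have hm0 : m < 0 := by
    rw [hm] at hneg
    exact_mod_cast hneg
  refine ⟨m, hm0, hm, fun i hi => ?_⟩
  have h1 := hle' i hi.le
  rw [hm] at h1
  cases hv : v (c i) with
  | top => exact WithTop.coe_lt_top _
  | coe s =>
    rw [hv] at h1
    norm_cast at *
    push_cast at *
    have h2 : (q : ℤ) ^ i + 1 ≤ q ^ r := by exact_mod_cast Nat.pow_lt_pow_right hq hi
    have h3 : (1 : ℤ) ≤ q ^ i := by exact_mod_cast Nat.one_le_pow _ _ (by omega)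
    rcases hα.lt_or_eq with h | h
    · nlinarith
    · have h4 : (q : ℤ) ^ i + 2 ≤ q ^ r := by exact_mod_cast hα' h i hi
      rw [h] at h1
      nlinarith

end escape

/-! ### Local heights of escaping points. -/

section height

variable {k A K : Type*} [Field k] [Fintype k] [CommRing A] [Algebra k A] [Field K] [Algebra k K]
  (D : DrinfeldModule k A K) (L : Type*) [Field L] [Algebra K L]

/-- The coefficients in `L` of `φ t`, as a polynomial in `τ`. -/
noncomputable def tauCoeff (t : A) (i : ℕ) : L :=
  algebraMap K L ((D.φ t).coeff (Fintype.card k ^ i))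

variable {L} (v : AddValuation L (WithTop ℤ)) {a t : A} {r : ℕ}

theorem tauCoeff_eq_one (hmonic : (D.φ t).Monic) (hr : (D.φ t).natDegree = Fintype.card k ^ r) :
    D.tauCoeff L t r = 1 := by
  rw [tauCoeff, ← hr, hmonic.coeff_natDegree, map_one]

theorem aeval_φ_eq_sum_tauCoeff (hr : (D.φ t).natDegree = Fintype.card k ^ r) (y : L) :
    aeval y (D.φ t) = ∑ i ∈ Finset.range (r + 1), D.tauCoeff L t i * y ^ Fintype.card k ^ i :=
  D.aeval_φ_eq_sum t hr y

/-- Along the orbit of an escaping point under φ_t the truncated valuation is multiplied by exactly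
deg φ_t, as `heightV_eq_vTilde` requires. -/
theorem heightV_of_escapes (ha : 2 ≤ (D.φ a).natDegree) (ht : 2 ≤ (D.φ t).natDegree)
    (hmonic : (D.φ t).Monic) (hr : (D.φ t).natDegree = Fintype.card k ^ r) {z : L} {e : ℤ}
    (h : Escapes v (Fintype.card k) r (D.tauCoeff L t) z e) : D.heightV v a z = e := by
  have key : ∀ m, Escapes v (Fintype.card k) r (D.tauCoeff L t) (aeval z (D.φ (t ^ m)))
      ((Fintype.card k ^ r) ^ m * e) := by
    intro m
    induction m with
    | zero => simpa [φ_one] using h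
    | succ m ih =>
      have := ih.map Fintype.card_pos (D.tauCoeff_eq_one hmonic hr)
      rw [← D.aeval_φ_eq_sum_tauCoeff hr, ← aeval_φ_mul, ← pow_succ'] at this
      convert this using 1
      ring
  have hval : ∀ {z : L} {e : ℤ}, Escapes v (Fintype.card k) r (D.tauCoeff L t) z e →
      vTilde v z = e := by
    intro z e h
    have h1 := vTilde_eq_of_neg v (y := z) (by rw [h.2.1]; exact_mod_cast h.1)
    rw [h.2.1] at h1
    exact_mod_cast h1
  rw [D.heightV_eq_vTilde v ha ht, hval h]
  intro m
  rw [hval (key m), hval h, hr]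
  push_cast
  ring

theorem neg_le_of_escapes (ha : 2 ≤ (D.φ a).natDegree) (ht : 2 ≤ (D.φ t).natDegree)
    (hmonic : (D.φ t).Monic) (hr : (D.φ t).natDegree = Fintype.card k ^ r) {ξ : L} {b : A}
    (hb : D.φ b ≠ 0) {e : ℤ}
    (h : Escapes v (Fintype.card k) r (D.tauCoeff L t) (aeval ξ (D.φ b)) e) :
    (-e : ℝ) = (D.φ b).natDegree * -D.heightV v a ξ := by
  have h1 := D.heightV_of_escapes v ha ht hmonic hr h
  rw [D.heightV_aeval_φ v ha hb] at h1
  linarith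

/-- The source of the lower bound: an escaping point has integral valuation e ≤ -1, so its local
height is not small. -/
theorem not_escapes (ha : 2 ≤ (D.φ a).natDegree) (ht : 2 ≤ (D.φ t).natDegree)
    (hmonic : (D.φ t).Monic) (hr : (D.φ t).natDegree = Fintype.card k ^ r) {ξ : L} {b : A}
    (hb : D.φ b ≠ 0) (hlt : (D.φ b).natDegree * -D.heightV v a ξ < 1) (e : ℤ) :
    ¬ Escapes v (Fintype.card k) r (D.tauCoeff L t) (aeval ξ (D.φ b)) e := by
  intro h
  rw [← D.neg_le_of_escapes v ha ht hmonic hr hb h] at hlt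
  have h1 : e ≤ -1 := by
    have := h.1
    omega
  have h2 : (e : ℝ) ≤ -1 := by exact_mod_cast h1
  linarith

/-- Bad reduction is visible on φ_t alone: integrality of the monic φ_t passes to every φ_a by
commutation. -/
theorem exists_tauCoeff_neg (hne : ∀ a : A, a ≠ 0 → D.φ a ≠ 0) (ht : 2 ≤ (D.φ t).natDegree)
    (hmonic : (D.φ t).Monic) (hr : (D.φ t).natDegree = Fintype.card k ^ r)
    (hbad : ¬ D.GoodReduction v) : ∃ j < r, v (D.tauCoeff L t j) < 0 := by
  by_contra hcon
  push Not at hcon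
  refine hbad (D.goodReduction_of_coeff_nonneg v hne ht hmonic fun j => ?_)
  by_cases hj : j ∈ (D.φ t).support
  · obtain ⟨i, rfl⟩ := D.linearized t j hj
    have h1 := le_natDegree_of_mem_supp _ hj
    rw [hr] at h1
    have h2 := (Nat.pow_le_pow_iff_right Fintype.one_lt_card).mp h1
    rcases h2.lt_or_eq with h | rfl
    · exact hcon i h
    · have := D.tauCoeff_eq_one (L := L) hmonic hr
      rw [tauCoeff] at this
      rw [this, v.map_one]
  · rw [notMem_support_iff.mp hj, map_zero, v.map_zero]
    exact le_top

theorem tauCoeff_nonneg (ht : t ≠ 0) (hgood : D.GoodReduction v) (i : ℕ) :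
    0 ≤ v (D.tauCoeff L t i) :=
  (hgood t ht).1 _

theorem heightV_eq_zero_of_goodReduction [IsDomain A] (ha : 2 ≤ (D.φ a).natDegree)
    (hgood : D.GoodReduction v) {y : L} (hy : 0 ≤ v y) : D.heightV v a y = 0 := by
  refine D.heightV_eq_zero v ha fun m => ?_
  have ha0 : a ≠ 0 := by
    rintro rfl
    rw [φ_zero, natDegree_zero] at ha
    omega
  rw [aeval_eq_sum_range]
  refine v.map_le_sum fun i _ => ?_
  rw [Algebra.smul_def, v.map_mul, v.map_pow]
  exact add_nonneg ((hgood _ (pow_ne_zero m ha0)).1 i) (nsmul_nonneg hy i)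

end height

end DrinfeldModule

/-! ### Constants -/

section constants

variable {k L : Type*} [Field k] [Finite k] [Field L] [Algebra k L]

theorem finite_adjoin_of_isIntegral {s : Set L} (hs : s.Finite) (hint : ∀ y ∈ s, IsIntegral k y) :
    Finite (Algebra.adjoin k s) := by
  have : Module.Finite k (Algebra.adjoin k s) :=
    Module.Finite.iff_fg.mpr (fg_adjoin_of_finite hs hint)
  exact Module.finite_of_finite k

/-- The powers of y lie in a finite ring, so two of them agree. -/
theorem AddValuation.map_eq_zero_of_isIntegral (v : AddValuation L (WithTop ℤ)) {y : L}
    (hy : IsIntegral k y) (hy0 : y ≠ 0) : v y = 0 := by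
  have := finite_adjoin_of_isIntegral (Set.finite_singleton y) (k := k) (by simpa using hy)
  obtain ⟨m, n, hmn, h⟩ := Finite.exists_ne_map_eq_of_infinite
    (fun m : ℕ => (⟨y, Algebra.self_mem_adjoin_singleton k y⟩ : Algebra.adjoin k {y}) ^ m)
  have h1 : y ^ m = y ^ n := congrArg Subtype.val h
  obtain ⟨e, he⟩ := v.exists_eq_coe hy0
  have h2 := congrArg v h1
  rw [DrinfeldModule.map_pow_eq_coe v he, DrinfeldModule.map_pow_eq_coe v he] at h2
  have h3 : (m : ℤ) * e = n * e := by exact_mod_cast h2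
  rw [he]
  by_contra hne
  have he0 : e ≠ 0 := fun h => hne (by rw [h]; rfl)
  exact hmn (by exact_mod_cast mul_right_cancel₀ he0 h3)

end constants

/-! ### Pigeonhole in the group of polynomials of bounded degree. -/

theorem natCard_degreeLT (k : Type*) [Field k] [Fintype k] (M : ℕ) :
    Nat.card (degreeLT k M) = Fintype.card k ^ M := by
  rw [Nat.card_congr (degreeLTEquiv k M).toEquiv, Nat.card_eq_fintype_card, Fintype.card_fun,
    Fintype.card_fin]

/-- The intersection has index at most q^(rs) in a group of order q^((r² + r)s + 1), and the
exponent left over is r²s + 1 ≥ 2. -/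
theorem sq_le_card_iInf_of_index_le {G ι : Type*} [AddCommGroup G] [Finite G] {S : Set ι}
    (hSfin : S.Finite) (hS : S.Nonempty) {q r : ℕ} (hq : 0 < q) (hr : 0 < r)
    (hG : Nat.card G = q ^ ((r ^ 2 + r) * S.ncard + 1)) (H : S → AddSubgroup G)
    (hH : ∀ w, (H w).index ≤ q ^ r) : q ^ 2 ≤ Nat.card (⨅ w, H w : AddSubgroup G) := by
  have : Fintype S := hSfin.fintype
  have hspos : 1 ≤ S.ncard := (Set.ncard_pos hSfin).mpr hS
  have hind : (⨅ w, H w).index ≤ (q ^ r) ^ S.ncard := by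
    refine (AddSubgroup.index_iInf_le _).trans ?_
    have hcS : S.ncard = (Finset.univ : Finset S).card := by
      rw [Set.ncard_eq_toFinset_card', Set.toFinset_card, Finset.card_univ]
    rw [hcS, ← Finset.prod_const]
    exact Finset.prod_le_prod' fun w _ => hH w
  generalize S.ncard = s at *
  have h1 := (⨅ w, H w).card_mul_index
  have h2 : Nat.card G ≤ Nat.card (⨅ w, H w : AddSubgroup G) * q ^ (r * s) :=
    h1.symm.le.trans (Nat.mul_le_mul_left _ (hind.trans_eq (pow_mul q r s).symm))
  have h3 : q ^ 2 * q ^ (r * s) ≤ Nat.card G := by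
    rw [hG, ← pow_add]
    refine Nat.pow_le_pow_right hq ?_
    have : 1 ≤ r ^ 2 * s := Nat.one_le_iff_ne_zero.mpr (by positivity)
    rw [add_mul]
    omega
  exact Nat.le_of_mul_le_mul_right (h3.trans h2) (by positivity)

namespace DrinfeldModule

/-! ### The lower bound for the local height -/

section lehmer

variable {k A K : Type*} [Field k] [Fintype k] [CommRing A] [Algebra k A] [Field K] [Algebra k K]
  (D : DrinfeldModule k A K) {L : Type*} [Field L] [Algebra K L]

/-- The additive map `g ↦ φ_{g(t)}(ξ)` on polynomials in `t`. -/
noncomputable def pointHom (t : A) (ξ : L) : k[X] →+ L where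
  toFun g := aeval ξ (D.φ (aeval t g))
  map_zero' := by rw [_root_.map_zero, φ_zero, _root_.map_zero]
  map_add' g h := by rw [_root_.map_add, D.map_add, _root_.map_add]

variable {t : A} {ξ : L}

theorem pointHom_apply (g : k[X]) : D.pointHom t ξ g = aeval ξ (D.φ (aeval t g)) := rfl

theorem pointHom_injective (ht : Transcendental k t) (hξ : ¬ D.IsTorsion ξ) :
    Function.Injective (D.pointHom t ξ) := by
  rw [injective_iff_map_eq_zero]
  intro g hg
  by_contra hg0
  exact hξ ⟨aeval t g, fun h => hg0 (transcendental_iff.mp ht g h), hg⟩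

variable {a : A} {r : ℕ} (ha : 2 ≤ (D.φ a).natDegree) (ht2 : 2 ≤ (D.φ t).natDegree)
  (hmonic : (D.φ t).Monic) (hr : (D.φ t).natDegree = Fintype.card k ^ r)
  (hne : ∀ a : A, a ≠ 0 → D.φ a ≠ 0) (ht : Transcendental k t)
include ha ht2 hmonic hr hne ht

variable (v : AddValuation L (WithTop ℤ))

omit ha hmonic hne ht in
theorem natDegree_φ_aeval_le_of_lt {N : ℕ} {g : k[X]} (hg : g.natDegree ≤ N) :
    (D.φ (aeval t g)).natDegree ≤ (Fintype.card k ^ r) ^ N := by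
  refine (D.natDegree_φ_aeval_le (by omega) g).trans ?_
  rw [hr]
  exact Nat.pow_le_pow_right (by omega) hg

theorem pointHom_not_escapes {N : ℕ}
    (hV : (((Fintype.card k ^ r) ^ N : ℕ) : ℝ) * -D.heightV v a ξ ≤ 1) {g : k[X]} (hg0 : g ≠ 0)
    (hg : g.natDegree < N) (e : ℤ) :
    ¬ Escapes v (Fintype.card k) r (D.tauCoeff L t) (D.pointHom t ξ g) e := by
  have hb : D.φ (aeval t g) ≠ 0 := hne _ fun h => hg0 (transcendental_iff.mp ht g h)
  apply D.not_escapes v ha ht2 hmonic hr hb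
  have hV0 : 0 ≤ -D.heightV v a ξ := by linarith [D.heightV_nonpos v ha ξ]
  have h1 : (D.φ (aeval t g)).natDegree < (Fintype.card k ^ r) ^ N :=
    lt_of_le_of_lt (D.natDegree_φ_aeval_le_of_lt ht2 hr le_rfl)
      (Nat.pow_lt_pow_right (by omega) hg)
  rcases hV0.lt_or_eq with h | h
  · have h2 : ((D.φ (aeval t g)).natDegree : ℝ) < (((Fintype.card k ^ r) ^ N : ℕ) : ℝ) := by
      exact_mod_cast h1
    have := mul_lt_mul_of_pos_right h2 h
    linarith
  · rw [← h]; simp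

omit ha ht2 hmonic hr hne ht in
theorem aeval_pointHom (g : k[X]) : aeval (D.pointHom t ξ g) (D.φ t) = D.pointHom t ξ (X * g) := by
  rw [pointHom_apply, pointHom_apply, ← aeval_φ_mul, _root_.map_mul, aeval_X]

/-- At a place of good reduction the points `φ_{g(t)}(ξ)` are integral. -/
theorem pointHom_nonneg {N : ℕ}
    (hV : (((Fintype.card k ^ r) ^ N : ℕ) : ℝ) * -D.heightV v a ξ ≤ 1)
    (hint : ∀ i < r, 0 ≤ v (D.tauCoeff L t i)) {g : k[X]} (hg : g.natDegree < N) :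
    0 ≤ v (D.pointHom t ξ g) := by
  by_cases hg0 : g = 0
  · simp [hg0]
  by_contra hneg
  push Not at hneg
  have h0 : D.pointHom t ξ g ≠ 0 := by
    intro h
    rw [h, v.map_zero] at hneg
    exact not_top_lt hneg
  obtain ⟨e, he⟩ := v.exists_eq_coe h0
  refine D.pointHom_not_escapes ha ht2 hmonic hr hne ht v hV hg0 hg e
    (escapes_of_integral Fintype.one_lt_card he ?_ hint)
  rw [he] at hneg
  exact_mod_cast hneg

variable [Algebra k L]

/-- At a place of bad reduction, the points `φ_{g(t)}(ξ)` of valuation larger than `β` form a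
subgroup of small index. -/
theorem index_levelSubgroup_le {N : ℕ}
    (hV : (((Fintype.card k ^ r) ^ N : ℕ) : ℝ) * -D.heightV v a ξ ≤ 1)
    (hbad : ∃ j < r, v (D.tauCoeff L t j) < 0) {β : ℤ} (hβ : β ≤ 0)
    (hβ' : β = 0 → ∀ i < r, Fintype.card k ^ i + 2 ≤ Fintype.card k ^ r) {M : ℕ} (hM : M < N) :
    (levelSubgroup v ((D.pointHom t ξ).comp (degreeLT k M).subtype.toAddMonoidHom)
      (β + 1)).index ≤ Fintype.card k ^ r := by
  set θ := (D.pointHom t ξ).comp (degreeLT k M).subtype.toAddMonoidHom with hθ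
  have hθ' : ∀ g : degreeLT k M, θ g = D.pointHom t ξ (g : k[X]) := fun g => rfl
  have hfin : Finite (degreeLT k M) := Finite.of_equiv _ (degreeLTEquiv k M).symm.toEquiv
  obtain ⟨p, hp⟩ := CharP.exists k
  obtain ⟨e, hpp, hcard⟩ := FiniteField.card k p
  have : Fact p.Prime := ⟨hpp⟩
  have : CharP L p := charP_of_injective_algebraMap (algebraMap k L).injective p
  have h := card_le_card_levelSubgroup v θ (p := p) (e := e) e.ne_zero (r := r)
    (a := D.tauCoeff L t) (by rw [D.tauCoeff_eq_one hmonic hr]; exact one_ne_zero) β (by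
      intro g hg
      rw [← hcard]
      by_contra hcon
      push Not at hcon
      have hg0 : (g : k[X]) ≠ 0 := by
        intro h0
        rw [hθ', h0, _root_.map_zero, v.map_zero, top_le_iff] at hg
        exact WithTop.coe_ne_top hg
      have hy0 : θ g ≠ 0 := by
        intro h0
        rw [h0, v.map_zero, top_le_iff] at hg
        exact WithTop.coe_ne_top hg
      obtain ⟨α, hα⟩ := v.exists_eq_coe hy0
      have hαβ : α ≤ β := by
        rw [hα] at hg
        exact_mod_cast hg
      obtain ⟨e', he'⟩ := exists_escapes_of_le (c := D.tauCoeff L t) Fintype.one_lt_card hα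
        (hαβ.trans hβ) (fun h0 => hβ' (by omega)) hbad hcon
      rw [← D.aeval_φ_eq_sum_tauCoeff hr, hθ', aeval_pointHom] at he'
      -- Applying φ_t raises the degree of g by one; the strict inequality M < N leaves room for
      -- this.
      refine D.pointHom_not_escapes ha ht2 hmonic hr hne ht v hV
        (mul_ne_zero X_ne_zero hg0) ?_ e' he'
      rw [natDegree_X_mul hg0]
      have := (natDegree_lt_iff_degree_lt hg0).mpr (mem_degreeLT.mp g.2)
      omega)
  rw [← hcard, ← AddSubgroup.card_mul_index (levelSubgroup v θ (β + 1))] at h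
  exact Nat.le_of_mul_le_mul_left h Nat.card_pos

-- Here φ_t(z) = z(z + c) with v(c) = γ < 0. A point y with y and y + 1 both units has v(φ_t(y)) =
-- γ, which need not escape, but v(φ_t(φ_t(y))) = 2γ, which does. Its height is at least 2, so
-- degree N is still permitted.
omit [Algebra k L] in
theorem false_of_card_eq_two {N : ℕ}
    (hV : (((Fintype.card k ^ r) ^ N : ℕ) : ℝ) * -D.heightV v a ξ ≤ 1)
    (hq : Fintype.card k = 2) (hr1 : r = 1) (hneg : v (D.tauCoeff L t 0) < 0) {g : k[X]}
    (hg0 : g ≠ 0) (hg : g.natDegree + 2 ≤ N) (hvy : v (D.pointHom t ξ g) = 0)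
    (hvy1 : v (D.pointHom t ξ g + 1) = 0) : False := by
  set y := D.pointHom t ξ g with hy
  set c := D.tauCoeff L t 0 with hcdef
  have hc0 : c ≠ 0 := by
    intro h
    rw [h, v.map_zero] at hneg
    exact not_top_lt hneg
  obtain ⟨γ, hγ⟩ := v.exists_eq_coe hc0
  have hγ0 : γ < 0 := by
    rw [hγ] at hneg
    exact_mod_cast hneg
  have hf : ∀ z : L, aeval z (D.φ t) = z * (z + c) := by
    intro z
    have hone := D.tauCoeff_eq_one (L := L) hmonic hr
    rw [hr1] at hone
    rw [D.aeval_φ_eq_sum_tauCoeff hr, hr1, Finset.sum_range_succ, Finset.sum_range_one, hone, hq]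
    ring
  have hval : v (D.pointHom t ξ (X * (X * g))) = ((2 * γ : ℤ) : WithTop ℤ) := by
    rw [← aeval_pointHom, ← aeval_pointHom, ← hy, hf, hf]
    have h1 : v (y + c) = γ := by
      rw [v.map_add_eq_of_lt_right, hγ]
      rwa [hvy]
    have h2 : v (y * (y + c) + c) = γ := by
      -- This is where y + 1 must be a unit: it excludes cancellation between c · y and c.
      have : y * (y + c) + c = y ^ 2 + c * (y + 1) := by ring
      have hcv : v (c * (y + 1)) = γ := by rw [v.map_mul, hvy1, add_zero, hγ]
      rw [this, v.map_add_eq_of_lt_right, hcv]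
      rw [hcv, v.map_pow, hvy, smul_zero]
      exact_mod_cast hγ0
    rw [v.map_mul, v.map_mul, hvy, h1, h2, zero_add, two_mul, WithTop.coe_add]
  have hesc : Escapes v (Fintype.card k) r (D.tauCoeff L t) (D.pointHom t ξ (X * (X * g)))
      (2 * γ) := by
    refine ⟨by omega, hval, fun i hi => ?_⟩
    have hi0 : i = 0 := by omega
    rw [hi0, ← hcdef, hγ, hr1, hq]
    norm_cast
    omega
  have hb : D.φ (aeval t (X * (X * g))) ≠ 0 := hne _ fun h =>
    mul_ne_zero X_ne_zero (mul_ne_zero X_ne_zero hg0) (transcendental_iff.mp ht _ h)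
  have h1 := D.neg_le_of_escapes v ha ht2 hmonic hr hb hesc
  have h2 : (D.φ (aeval t (X * (X * g)))).natDegree ≤ (Fintype.card k ^ r) ^ N := by
    apply D.natDegree_φ_aeval_le_of_lt ht2 hr
    rw [natDegree_X_mul (mul_ne_zero X_ne_zero hg0), natDegree_X_mul hg0]
    omega
  have h4 : 0 ≤ -D.heightV v a ξ := by linarith [D.heightV_nonpos v ha ξ]
  have h5 : ((D.φ (aeval t (X * (X * g)))).natDegree : ℝ) ≤
      (((Fintype.card k ^ r) ^ N : ℕ) : ℝ) := by exact_mod_cast h2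
  have h6 := mul_le_mul_of_nonneg_right h5 h4
  have h7 : (((2 * γ : ℤ)) : ℝ) ≤ -2 := by exact_mod_cast (by omega : 2 * γ ≤ -2)
  linarith

omit ha ht2 hmonic hne in
/-- A point all of whose multiples are constants is a torsion point. -/
theorem isTorsion_of_isIntegral (hξ : IsIntegral k ξ)
    (hc : ∀ i ≤ r, IsIntegral k (D.tauCoeff L t i)) : D.IsTorsion ξ := by
  set s : Set L := insert ξ (D.tauCoeff L t '' Set.Iic r) with hs
  have hfin : Finite (Algebra.adjoin k s) := by
    refine finite_adjoin_of_isIntegral (((Set.finite_Iic r).image _).insert _) ?_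
    rintro y (rfl | ⟨i, hi, rfl⟩)
    · exact hξ
    · exact hc i hi
  have hmem : ∀ m : ℕ, aeval ξ (D.φ (t ^ m)) ∈ Algebra.adjoin k s := by
    intro m
    induction m with
    | zero =>
      rw [pow_zero, φ_one, aeval_X]
      exact Algebra.subset_adjoin (Set.mem_insert _ _)
    | succ m ih =>
      rw [pow_succ', aeval_φ_mul, D.aeval_φ_eq_sum_tauCoeff hr]
      refine Subalgebra.sum_mem _ fun i hi => Subalgebra.mul_mem _ ?_ (Subalgebra.pow_mem _ ih _)
      exact Algebra.subset_adjoin (Set.mem_insert_of_mem _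
        ⟨i, Nat.lt_succ_iff.mp (Finset.mem_range.mp hi), rfl⟩)
  obtain ⟨m, n, hmn, h⟩ := Finite.exists_ne_map_eq_of_infinite
    (fun m : ℕ => (⟨_, hmem m⟩ : Algebra.adjoin k s))
  have h1 : D.pointHom t ξ (X ^ m) = D.pointHom t ξ (X ^ n) := by
    have := congrArg Subtype.val h
    simpa [pointHom_apply] using this
  by_contra hξt
  have h2 := D.pointHom_injective ht hξt h1
  have h3 := congrArg natDegree h2
  rw [natDegree_X_pow, natDegree_X_pow] at h3
  exact hmn h3

variable {F K₀ : Type*} [Field F] [Field K₀] [Algebra F K₀] {n : ℕ} {X : Fin n → K₀}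
  [Algebra K₀ L] [FiniteDimensional K₀ L]

-- Each bad place is a pole of one of the finitely many coefficients of φ_t.
omit ha ht [Algebra k L] in
theorem finite_badPlaces (hX : IsRationalBasis F X) : (badPlaces F X L D).Finite := by
  have hsub : badPlaces F X L D ⊆ ⋃ i ∈ Finset.range r,
      {w ∈ places F X L | w (D.tauCoeff L t i) < 0} := by
    rintro w ⟨hw, hbad⟩
    obtain ⟨j, hj, hneg⟩ := D.exists_tauCoeff_neg w hne ht2 hmonic hr hbad
    simp only [Set.mem_iUnion, Finset.mem_range]
    exact ⟨j, hj, hw, hneg⟩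
  exact Set.Finite.subset (Set.Finite.biUnion (Finset.finite_toSet _)
    fun i _ => hX.finite_setOf_places_neg _) hsub

/-- The core of the argument: if all local heights were small, some point φ_{g(t)}(ξ) would be a
constant that the bad places do not allow, or ξ would be torsion. -/
theorem exists_lt_heightV (hX : IsRationalBasis F X)
    (hconst : ∀ y : L, (∃ p : F[X], p.Monic ∧ aeval y (p.map (algebraMap F K₀)) = 0) →
      IsIntegral k y)
    (hξ : ¬ D.IsTorsion ξ) : ∃ w ∈ places F X L,
      1 < (((Fintype.card k ^ r) ^ (2 + (r ^ 2 + r) * (badPlaces F X L D).ncard) : ℕ) : ℝ) *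
        -D.heightV w a ξ := by
  by_contra hcon
  push Not at hcon
  set q := Fintype.card k with hq
  have hq2 : 2 ≤ q := Fintype.one_lt_card
  set S := badPlaces F X L D with hS
  have hSfin : S.Finite := D.finite_badPlaces ht2 hmonic hr hne hX
  set s := S.ncard with hs
  set N := 2 + (r ^ 2 + r) * s with hN
  have hr1 : 1 ≤ r := by
    by_contra h
    have h0 : r = 0 := by omega
    rw [hr, h0, pow_zero] at ht2
    omega
  have ht0 : t ≠ 0 := by
    rintro rfl
    rw [φ_zero, natDegree_zero] at ht2
    omega
  have hgood : ∀ w ∈ places F X L, w ∉ S → ∀ g : k[X], g.natDegree < N →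
      0 ≤ w (D.pointHom t ξ g) := by
    intro w hw hwS g hg
    have hred : D.GoodReduction w := by
      by_contra h
      exact hwS ⟨hw, h⟩
    exact D.pointHom_nonneg ha ht2 hmonic hr hne ht w (hcon w hw)
      (fun i _ => D.tauCoeff_nonneg w ht0 hred i) hg
  have hinteg : ∀ y : L, (∀ w ∈ places F X L, 0 ≤ w y) → IsIntegral k y := fun y hy =>
    hconst y (hX.exists_monic_aeval_eq_zero hy)
  rcases S.eq_empty_or_nonempty with hemp | ⟨w₀, hw₀⟩
  · have hnS : ∀ w, w ∉ S := fun w => by rw [hemp]; exact Set.notMem_empty w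
    refine hξ (D.isTorsion_of_isIntegral hr ht (hinteg ξ fun w hw => ?_)
      fun i _ => hinteg _ fun w hw => ?_)
    · have := hgood w hw (hnS w) 1 (by rw [natDegree_one]; omega)
      simpa [pointHom_apply, φ_one] using this
    · refine D.tauCoeff_nonneg w ht0 ?_ i
      by_contra h
      exact hnS w ⟨hw, h⟩
  · have hspos : 1 ≤ s := (Set.ncard_pos hSfin).mpr ⟨w₀, hw₀⟩
    -- Points with deg g < M = N - 1, so that their images under φ_t still correspond to degrees
    -- below N.
    set M := (r ^ 2 + r) * s + 1 with hM
    have hMN : M < N := by omega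
    set θ := (D.pointHom t ξ).comp (degreeLT k M).subtype.toAddMonoidHom with hθ
    have hθ' : ∀ g : degreeLT k M, θ g = D.pointHom t ξ (g : k[X]) := fun g => rfl
    have hθinj : Function.Injective θ :=
      (D.pointHom_injective ht hξ).comp Subtype.val_injective
    have hdeg : ∀ g : degreeLT k M, (g : k[X]) ≠ 0 → (g : k[X]).natDegree < M := fun g hg =>
      (natDegree_lt_iff_degree_lt hg).mpr (mem_degreeLT.mp g.2)
    have hdeg' : ∀ g : degreeLT k M, (g : k[X]).natDegree < N := by
      intro g
      by_cases hg : (g : k[X]) = 0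
      · rw [hg, natDegree_zero]; omega
      · have := hdeg g hg
        omega
    have hfin : Finite (degreeLT k M) := Finite.of_equiv _ (degreeLTEquiv k M).symm.toEquiv
    have hindex : ∀ w ∈ S, ∀ β : ℤ, β ≤ 0 → (β = 0 → ∀ i < r, q ^ i + 2 ≤ q ^ r) →
        (levelSubgroup w θ (β + 1)).index ≤ q ^ r := fun w hw β hβ hβ' =>
      D.index_levelSubgroup_le ha ht2 hmonic hr hne ht w (N := N) (hcon w hw.1)
        (D.exists_tauCoeff_neg w hne ht2 hmonic hr hw.2) hβ hβ' hMN
    have hcard : ∀ β : ℤ, β ≤ 0 → (β = 0 → ∀ i < r, q ^ i + 2 ≤ q ^ r) →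
        q ^ 2 ≤ Nat.card (⨅ w : S, levelSubgroup (w : AddValuation L (WithTop ℤ)) θ (β + 1) :
          AddSubgroup (degreeLT k M)) := fun β hβ hβ' =>
      sq_le_card_iInf_of_index_le hSfin ⟨w₀, hw₀⟩ (by omega) hr1 (natCard_degreeLT k M) _ fun w =>
        hindex w w.2 β hβ hβ'
    have hmemH : ∀ {β : ℤ} {g : degreeLT k M},
        g ∈ (⨅ w : S, levelSubgroup (w : AddValuation L (WithTop ℤ)) θ (β + 1) :
          AddSubgroup (degreeLT k M)) →
        ∀ w ∈ S, ((β + 1 : ℤ) : WithTop ℤ) ≤ w (D.pointHom t ξ (g : k[X])) := by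
      intro β g hg w hw
      rw [AddSubgroup.mem_iInf] at hg
      exact hg ⟨w, hw⟩
    -- The gap needed at level β = 0. If it is available, a nonzero common point is a constant of
    -- positive valuation at w₀, a contradiction.
    by_cases hspecial : ∀ i < r, q ^ i + 2 ≤ q ^ r
    · have hc := hcard 0 le_rfl fun _ => hspecial
      have hnt : Nontrivial (⨅ w : S, levelSubgroup (w : AddValuation L (WithTop ℤ)) θ (0 + 1) :
          AddSubgroup (degreeLT k M)) := by
        rw [← Finite.one_lt_card_iff_nontrivial]
        nlinarith
      obtain ⟨⟨g, hg⟩, hg0⟩ := exists_ne (0 : (⨅ w : S,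
        levelSubgroup (w : AddValuation L (WithTop ℤ)) θ (0 + 1) : AddSubgroup (degreeLT k M)))
      have hy0 : D.pointHom t ξ (g : k[X]) ≠ 0 := by
        intro h
        rw [← hθ', map_eq_zero_iff θ hθinj] at h
        exact hg0 (Subtype.ext h)
      have hint := hinteg (D.pointHom t ξ (g : k[X])) fun w hw => by
        by_cases hwS : w ∈ S
        · exact le_trans (by norm_num) (hmemH hg w hwS)
        · exact hgood w hw hwS g (hdeg' g)
      have h1 := hmemH hg w₀ hw₀
      rw [w₀.map_eq_zero_of_isIntegral hint hy0] at h1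
      norm_cast at h1
    · push Not at hspecial
      have hc := hcard (-1) (by norm_num) fun h => by norm_num at h
      obtain ⟨i, hir, hi⟩ := hspecial
      -- The gap fails only for r = 1 and q = 2, where q^r - q^0 = 1.
      have hr1' : r = 1 := by
        by_contra h
        have h1 : q ^ (i + 1) ≤ q ^ r := Nat.pow_le_pow_right (by omega) hir
        have h2 : q ^ 2 ≤ q ^ r := Nat.pow_le_pow_right (by omega) (by omega)
        rw [pow_succ] at h1
        rcases Nat.eq_zero_or_pos i with h3 | h3
        · rw [h3, pow_zero] at hi
          nlinarith
        · have h4 : q ^ 1 ≤ q ^ i := Nat.pow_le_pow_right (by omega) h3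
          nlinarith
      -- The intersection has at least q² ≥ 4 points, more than the two excluded values 0 and -1.
      obtain ⟨g, hg, hy0, hy1⟩ : ∃ g ∈ (⨅ w : S, levelSubgroup (w : AddValuation L (WithTop ℤ)) θ
          (-1 + 1) : AddSubgroup (degreeLT k M)), D.pointHom t ξ (g : k[X]) ≠ 0 ∧
          D.pointHom t ξ (g : k[X]) + 1 ≠ 0 := by
        by_contra hno
        push Not at hno
        classical
        have hle : Nat.card (⨅ w : S, levelSubgroup (w : AddValuation L (WithTop ℤ)) θ (-1 + 1) :
            AddSubgroup (degreeLT k M)) ≤ Nat.card ({0, -1} : Finset L) := by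
          refine Nat.card_le_card_of_injective (fun g => ⟨θ g, ?_⟩) ?_
          · rw [Finset.mem_insert, Finset.mem_singleton, hθ']
            by_cases h0 : D.pointHom t ξ ((g : degreeLT k M) : k[X]) = 0
            · exact Or.inl h0
            · exact Or.inr (eq_neg_of_add_eq_zero_left (hno _ g.2 h0))
          · intro g h hgh
            exact Subtype.ext (hθinj (congrArg Subtype.val hgh))
        have h2 : Nat.card ({0, -1} : Finset L) ≤ 2 := by
          rw [Nat.card_eq_fintype_card, Fintype.card_coe]
          exact Finset.card_le_two
        nlinarith
      have hint := hinteg (D.pointHom t ξ (g : k[X])) fun w hw => by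
        by_cases hwS : w ∈ S
        · exact le_trans (by norm_num) (hmemH hg w hwS)
        · exact hgood w hw hwS g (hdeg' g)
      obtain ⟨j, hj, hneg⟩ := D.exists_tauCoeff_neg w₀ hne ht2 hmonic hr hw₀.2
      have hj0 : j = 0 := by omega
      rw [hj0] at hneg
      have hqtwo : q = 2 := by
        have hi0 : i = 0 := by omega
        rw [hi0, hr1', pow_zero, pow_one] at hi
        omega
      have hg0 : (g : k[X]) ≠ 0 := by
        intro h
        rw [h, _root_.map_zero] at hy0
        exact hy0 rfl
      exact D.false_of_card_eq_two ha ht2 hmonic hr hne ht w₀ (hcon w₀ hw₀.1) hqtwo hr1' hneg hg0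
        (by have := hdeg g hg0; omega) (w₀.map_eq_zero_of_isIntegral hint hy0)
        (w₀.map_eq_zero_of_isIntegral (hint.add isIntegral_one) hy1)

end lehmer

end DrinfeldModule

/-! ### The rational function field inside a finitely generated field -/

section ratField

variable {F K : Type*} [Field F] [Field K] [Algebra F K] {n : ℕ} {X : Fin n → K}

theorem isRationalBasis_ratGen (hX : AlgebraicIndependent F X) :
    IsRationalBasis F (ratGen F X) := by
  have hcomp : ∀ P : MvPolynomial (Fin n) F,
      ((MvPolynomial.aeval (ratGen F X) P : ratField (F := F) X) : K) = MvPolynomial.aeval X P :=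
    fun P => MvPolynomial.aeval_algebraMap_apply K (ratGen F X) P ▸ rfl
  refine ⟨?_, fun z => ?_⟩
  · rw [← AlgHom.algebraicIndependent_iff (ratField (F := F) X).val Subtype.val_injective]
    exact hX
  · obtain ⟨a, b, hab⟩ := (IntermediateField.mem_adjoin_range_iff F X (z : K)).mp z.2
    by_cases hb : b = 0
    · refine ⟨0, 1, one_ne_zero, Subtype.val_injective ?_⟩
      rw [hab, hb]
      simp
    · refine ⟨a, b, hb, Subtype.val_injective ?_⟩
      rw [hab]
      push_cast
      rw [hcomp, hcomp]

/-- Finite generation over k together with algebraicity over F(X₁, …, Xₙ). -/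
theorem finiteDimensional_ratField {k : Type*} [Field k] [Algebra k F] [Algebra k K]
    [IsScalarTower k F K] (hK : (⊤ : IntermediateField k K).FG) (hX : IsTranscendenceBasis F X) :
    FiniteDimensional (ratField (F := F) X) K := by
  obtain ⟨s, hs, hsK⟩ := IntermediateField.fg_def.mp hK
  have halg : Algebra.IsAlgebraic (ratField (F := F) X) K := hX.isAlgebraic_field
  have : Finite s := hs
  have htop : IntermediateField.adjoin (ratField (F := F) X) s = ⊤ := by
    rw [eq_top_iff]
    intro y _
    have hy : y ∈ IntermediateField.adjoin k s := by rw [hsK]; trivial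
    induction hy using IntermediateField.adjoin_induction with
    | mem x hx => exact IntermediateField.subset_adjoin _ _ hx
    | algebraMap c =>
      have : algebraMap k K c = algebraMap (ratField (F := F) X) K (algebraMap F _
          (algebraMap k F c)) := by
        rw [IsScalarTower.algebraMap_apply k F K]; rfl
      rw [this]
      exact IntermediateField.algebraMap_mem _ _
    | add x y _ _ hx hy => exact add_mem (hx trivial) (hy trivial)
    | inv x _ hx => exact inv_mem (hx trivial)
    | mul x y _ _ hx hy => exact mul_mem (hx trivial) (hy trivial)
  have hfin : FiniteDimensional (ratField (F := F) X)
      (IntermediateField.adjoin (ratField (F := F) X) s) :=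
    IntermediateField.finiteDimensional_adjoin fun x _ => Algebra.IsIntegral.isIntegral x
  rw [htop] at hfin
  exact Module.Finite.equiv IntermediateField.topEquiv.toLinearEquiv

end ratField

namespace DrinfeldModule

/-! ### From a local height to the global height. -/

section global

variable {k A K : Type*} [Field k] [Fintype k] [CommRing A] [Algebra k A] [Field K]
  [Algebra k K] (D : DrinfeldModule k A K) {L : Type*} [Field L] [Algebra K L]
  {F K₀ : Type*} [Field F] [Field K₀] [Algebra F K₀] {n : ℕ} {X : Fin n → K₀}
  [Algebra K₀ L] [FiniteDimensional K₀ L]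

theorem localHeight_nonneg {a : A} (ha : 2 ≤ (D.φ a).natDegree) {w : AddValuation L (WithTop ℤ)}
    (hw : w ∈ places F X L) (y : L) : 0 ≤ localHeight F X D a w y := by
  rw [localHeight, neg_mul, ← mul_neg]
  exact mul_nonneg (placeDegree_pos_and_le hw).1.le (by linarith [D.heightV_nonpos w ha y])

/-- All terms are nonnegative, and only bad places and poles of y contribute. The finite support
matters, since `finsum` is 0 otherwise. -/
theorem localHeight_le_globalHeight [IsDomain A] {a : A} (ha : 2 ≤ (D.φ a).natDegree)
    (hX : IsRationalBasis F X) (hS : (badPlaces F X L D).Finite)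
    {w : AddValuation L (WithTop ℤ)} (hw : w ∈ places F X L) (y : L) :
    localHeight F X D a w y ≤ globalHeight F X D a y := by
  rw [globalHeight, finsum_mem_def]
  have h1 : localHeight F X D a w y =
      (places F X L).indicator (fun w => localHeight F X D a w y) w := by
    rw [Set.indicator_of_mem hw]
  rw [h1]
  refine single_le_finsum w ?_ fun w' =>
    Set.indicator_nonneg (fun w' hw' => D.localHeight_nonneg ha hw' y) w'
  refine Set.Finite.subset (hS.union (hX.finite_setOf_places_neg y)) fun w' hw' => ?_
  rw [Function.mem_support] at hw'
  have hmem : w' ∈ places F X L := by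
    by_contra h
    exact hw' (Set.indicator_of_notMem h _)
  rw [Set.indicator_of_mem hmem] at hw'
  by_contra hcon
  rw [Set.mem_union, not_or] at hcon
  have hgood : D.GoodReduction w' := by
    by_contra h
    exact hcon.1 ⟨hmem, h⟩
  have hy : 0 ≤ w' y := by
    by_contra h
    exact hcon.2 ⟨hmem, not_le.mp h⟩
  apply hw'
  rw [localHeight, D.heightV_eq_zero_of_goodReduction w' ha hgood hy, mul_zero]

end global

end DrinfeldModule

/-! ### The main theorem. -/

theorem theoremT
    -- the finite field with `q` elements, the curve, and `A`
    {k : Type*} [Field k] [Fintype k]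
    {Q : Type*} [Field Q] [Algebra k Q] (hQ : (⊤ : IntermediateField k Q).FG)
    (hQ' : Algebra.trdeg k Q = 1) (infty : ValuationSubring Q) (hinfty : infty ≠ ⊤)
    -- the finitely generated field `K` and its algebraic closure
    {K : Type*} [Field K] [Algebra k K] (hK : (⊤ : IntermediateField k K).FG)
    {Kalg : Type*} [Field Kalg] [Algebra K Kalg] [IsAlgClosure K Kalg]
    -- the Drinfeld module, with `φ_t` monic for some non-constant `t`
    (D : DrinfeldModule k (regularAway k Q infty) K)
    (t : regularAway k Q infty) (ht : Transcendental k t) (hmonic : (D.φ t).Monic)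
    (r : ℕ) (hr : (D.φ t).natDegree = Fintype.card k ^ r)
    -- a transcendence basis of `K / F`, `F` the algebraic closure of the prime field in `K`
    {n : ℕ} (X : Fin n → K) (hX : IsTranscendenceBasis (algebraicClosure k K) X)
    -- the non-constant element used to define the heights, which is arbitrary
    (a : regularAway k Q infty) (ha : Transcendental k a)
    (x : Kalg) (hx : ¬ D.IsTorsion x) :
    let F := algebraicClosure k K
    let K₀ := ratField (F := F) X
    let Kx := IntermediateField.adjoin K {x}
    let ξ : Kx := IntermediateField.AdjoinSimple.gen K x
    let M := places F (ratGen F X) Kx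
    let S := badPlaces F (ratGen F X) Kx D
    let c : ℝ := (Fintype.card k : ℝ) ^ (-((r * (2 + (r ^ 2 + r) * S.ncard) : ℕ) : ℤ))
    (∀ w ∈ M, Tendsto (D.heightSeq w a ξ) atTop (𝓝 (D.heightV w a ξ))) ∧
    S.Finite ∧
    (∃ w ∈ M, localHeight F (ratGen F X) D a w ξ > c * placeDegree F (ratGen F X) w) ∧
    globalHeight F (ratGen F X) D a ξ > c / (Module.finrank K₀ Kx : ℝ) := by
  intro F K₀ Kx ξ M S c
  have hdep := fun a b : regularAway k Q infty =>
    exists_eval₂_eq_zero_of_trdeg_eq_one hQ' (regularAway k Q infty) a b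
  have hne : ∀ a : regularAway k Q infty, a ≠ 0 → D.φ a ≠ 0 := fun a ha => D.φ_ne_zero hdep ha
  have ha2 := D.two_le_natDegree ha fun b => hdep a b ha
  have ht2 := D.two_le_natDegree ht fun b => hdep t b ht
  have hbasis : IsRationalBasis F (ratGen F X) := isRationalBasis_ratGen hX.1
  have hfinK : FiniteDimensional K₀ K := finiteDimensional_ratField hK hX
  have halg : Algebra.IsAlgebraic K Kalg := IsAlgClosure.isAlgebraic
  have hfinKx : FiniteDimensional K Kx :=
    IntermediateField.adjoin.finiteDimensional (Algebra.IsIntegral.isIntegral x)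
  have hfin : FiniteDimensional K₀ Kx := FiniteDimensional.trans K₀ K Kx
  have hS : S.Finite := D.finite_badPlaces ht2 hmonic hr hne hbasis
  have hξ : ¬ D.IsTorsion ξ := by
    rintro ⟨b, hb, h⟩
    refine hx ⟨b, hb, ?_⟩
    have h1 := congrArg (algebraMap Kx Kalg) h
    rw [← aeval_algebraMap_apply, _root_.map_zero] at h1
    exact h1
  let _ : Algebra k Kx := ((algebraMap K Kx).comp (algebraMap k K)).toAlgebra
  have htower : IsScalarTower k K Kx := IsScalarTower.of_algebraMap_eq fun _ => rfl
  -- F is algebraic over the finite field k, so an element algebraic over F is integral over k.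
  have hconst : ∀ y : Kx, (∃ p : F[X], p.Monic ∧ aeval y (p.map (algebraMap F K₀)) = 0) →
      IsIntegral k y := by
    rintro y ⟨p, hp, hpy⟩
    have htower' : IsScalarTower k F Kx := IsScalarTower.of_algebraMap_eq fun _ => rfl
    have hy : IsIntegral F y := by
      refine ⟨p, hp, ?_⟩
      rw [aeval_def, eval₂_map] at hpy
      exact hpy
    have : Algebra.IsIntegral k F := inferInstance
    exact isIntegral_trans y hy
  obtain ⟨w, hw, hlt⟩ :=
    D.exists_lt_heightV ha2 ht2 hmonic hr hne ht hbasis hconst hξ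
  have hcpos : 0 < c := zpow_pos (by exact_mod_cast Fintype.card_pos) _
  have hcV : c < -D.heightV w a ξ := by
    -- c is the inverse of q^(rN), the factor occurring in `exists_lt_heightV`.
    have hB : c = (((Fintype.card k ^ r) ^ (2 + (r ^ 2 + r) * S.ncard) : ℕ) : ℝ)⁻¹ := by
      simp only [c]
      rw [zpow_neg, zpow_natCast, pow_mul]
      push_cast
      rfl
    rw [hB, inv_lt_iff_one_lt_mul₀']
    · exact hlt
    · exact_mod_cast pow_pos (pow_pos Fintype.card_pos _) _
  have hdeg := placeDegree_pos_and_le hw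
  have hlocal : localHeight F (ratGen F X) D a w ξ > c * placeDegree F (ratGen F X) w := by
    rw [localHeight, neg_mul, ← mul_neg, mul_comm]
    exact mul_lt_mul_of_pos_right hcV hdeg.1
  refine ⟨fun w _ => D.tendsto_heightSeq w ha2 ξ, hS, ⟨w, hw, hlocal⟩, ?_⟩
  calc c / (Module.finrank K₀ Kx : ℝ) = c * (1 / (Module.finrank K₀ Kx : ℝ)) := by ring
    _ ≤ c * placeDegree F (ratGen F X) w := mul_le_mul_of_nonneg_left hdeg.2 hcpos.le
    _ < localHeight F (ratGen F X) D a w ξ := hlocal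
    _ ≤ _ := D.localHeight_le_globalHeight ha2 hbasis hS hw ξ
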